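/- Proposition 4.4 (A priori bound). Let $-\frac12<s<0$ and fix a sign $\pm$. With $\hat f(\xi)=(2\pi)^{-1/2}\int e^{-i\xi x}f(x)\,dx$ and $\kappa\ge1$ put $\|q\|_{H^s_\kappa}^2=\int(4\kappa^2+\xi^2)^s|\hat q(\xi)|^2\,d\xi$, $\|q\|_{H^s}=\|q\|_{H^s_1}$ and $B_\delta=\{q\in H^s(\mathbb R;\mathbb C):\|q\|_{H^s}\le\delta\}$. For $q\in H^s$ let $r=\pm\bar q$, and for real $|\varkappa|\ge1$ let $\Lambda=(\varkappa-\partial)^{-1/2}q(\varkappa+\partial)^{-1/2}$ and $\Gamma=(\varkappa+\partial)^{-1/2}r(\varkappa-\partial)^{-1/2}$ as operators on $L^2(\mathbb R)$, where $(\varkappa\mp\partial)^{-1/2}$ is the Fourier multiplier $(\varkappa\mp i\xi)^{-1/2}$ and $z^{-1/2}=|z|^{-1/2}e^{-i\arg(z)/2}$, $\arg z\in(-\pi,\pi]$. Define $$A(\varkappa;q)=\operatorname{sgn}(\varkappa)\sum_{m=1}^\infty\frac{(-1)^{m-1}}{m}\operatorname{tr}\{(\Lambda\Gamma)^m\},\qquad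 \alpha(\varkappa;q)=\pm\operatorname{Re}A(\varkappa;q)\quad(\varkappa\ge1).$$ There exist $\delta>0$ and $C>0$, depending only on $s$ and the sign, such that the following hold. (i) For every $q\in B_\delta$, $A(\varkappa;q)$ is well defined for all real $|\varkappa|\ge1$ ($\Lambda,\Gamma$ are bounded operators, every $(\Lambda\Gamma)^m$, $m\ge1$, is of trace class, and the series converges absolutely), and for every $\kappa\ge1$ the integral below converges absolutely and $$C^{-1}\|q\|_{H^s_\kappa}^2\le\int_\kappa^\infty\varkappa^{2s+1}\alpha(\varkappa;q)\,\frac{d\varkappa}{\varkappa}\le C\|q\|_{H^s_\kappa}^2 .$$ (ii) Let $J\subseteq\mathbb R$ be an interval containing $0$ and let $q:J\to\mathcal S(\mathbb R;\mathbb C)$ be an orbit of a Hamiltonian flow on Schwartz space, i.e. a solution of $i\frac{d}{dt}q=\frac{\delta H}{\delta r}$ for some $H:\mathcal S\to\mathbb R$, where $\frac d{d\theta}\big|_{\theta=0}H(q+\theta f)=\int f\,\frac{\delta H}{\delta q}\,dx\pm\int\bar f\,\frac{\delta H}{\delta r}\,dx$ for $f\in\mathcal S$. Suppose that $A(\varkappa)$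 is preserved for all real $|\varkappa|\ge1$: $A(\varkappa;q(t))=A(\varkappa;q(0))$ whenever $t\in J$ and $A(\varkappa;q(\tau))$ is well defined for all $\tau$ between $0$ and $t$. If $q(0)\in B_\delta$, then $$\|q(t)\|_{H^s_\kappa}\le C\|q(0)\|_{H^s_\kappa}\qquad\text{for all }t\in J\text{ and }\kappa\ge1 .$$ -/

import Mathlib

open MeasureTheory FourierTransform Set
open scoped SchwartzMap ComplexConjugate InnerProductSpace Real

noncomputable section

namespace AKNS

/-! Mathlib's Fourier transform is `𝓕 f ξ = ∫ exp (-2πi x ξ) f x dx`, so that the derivative `∂`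
acts as multiplication by `2πiξ`. The usual unitary convention
`f̂ ξ = (2π)^(-1/2) ∫ exp (-i x ξ) f x dx`, in which `∂` is multiplication by `iξ`, differs from it
by the unitary rescaling `ξ ↦ 2πξ` of the frequency. -/

/-- The complex Hilbert space `L²(ℝ)`. -/
abbrev L2 : Type := Lp ℂ 2 (volume : Measure ℝ)

/-! ### The spaces `H^σ_κ` -/

/-- The Fourier multiplier `(4κ² - ∂²)^(σ/2)` on tempered distributions. -/
def sobolevMultiplier (σ κ : ℝ) : 𝓢'(ℝ, ℂ) →L[ℂ] 𝓢'(ℝ, ℂ) :=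
  TemperedDistribution.fourierMultiplierCLM ℂ
    (fun ξ : ℝ => (((4 * κ ^ 2 + (2 * π * ξ) ^ 2) ^ (σ / 2) : ℝ) : ℂ))

open Classical in
/-- The norm `‖q‖_{H^σ_κ} = ‖(4κ² - ∂²)^(σ/2) q‖_{L²} = (∫ (4κ² + ξ²)^σ |q̂ ξ|² dξ)^(1/2)`
(set to `0` if `q` does not belong to `H^σ`). -/
def sobolevNorm (σ κ : ℝ) (q : 𝓢'(ℝ, ℂ)) : ℝ :=
  if h : ∃ f : L2, sobolevMultiplier σ κ q = (f : 𝓢'(ℝ, ℂ)) then ‖h.choose‖ else 0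

/-- The closed ball `B_δ` of `H^s`, for the norm `‖·‖_{H^s} = ‖·‖_{H^s_1}`. -/
def ball (s δ : ℝ) : Set 𝓢'(ℝ, ℂ) :=
  {q | TemperedDistribution.MemSobolev s 2 q ∧ sobolevNorm s 1 q ≤ δ}

/-! ### The operators `Λ` and `Γ` -/

/-- Complex conjugation on Schwartz functions. -/
def schwartzConj : 𝓢(ℝ, ℂ) →L[ℝ] 𝓢(ℝ, ℂ) :=
  SchwartzMap.postcompCLM (Complex.conjCLE : ℂ →L[ℝ] ℂ)

/-- The complex conjugate `q̄` of a tempered distribution, `q̄(u) = conj (q(ū))`. -/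
def distConj (q : 𝓢'(ℝ, ℂ)) : 𝓢'(ℝ, ℂ) :=
  ContinuousLinearMap.toPointwiseConvergenceCLM ℂ (RingHom.id ℂ) 𝓢(ℝ, ℂ) ℂ
    { toFun := fun u => conj (q (schwartzConj u))
      map_add' := fun u v => by simp
      map_smul' := fun c u => by
        have h : schwartzConj (c • u) = conj c • schwartzConj u := by
          ext x
          simp [schwartzConj]
        simp [h]
      cont := Complex.continuous_conj.comp (q.continuous.comp schwartzConj.continuous) }

/-- The companion `r = ± q̄` of `q`; the sign `ε` is `1` in the defocusing and `-1` in the focusing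
case. -/
def companion (ε : ℝ) (q : 𝓢'(ℝ, ℂ)) : 𝓢'(ℝ, ℂ) := (ε : ℂ) • distConj q

/-- Symbol of `(κ - ∂)^(-1/2)`; the power is `z^(-1/2) = |z|^(-1/2) exp (-i (arg z) / 2)` with
`arg z ∈ (-π, π]`. -/
def symMinus (κ ξ : ℝ) : ℂ := ((κ : ℂ) - 2 * π * ξ * Complex.I) ^ (-(1 / 2) : ℂ)

/-- Symbol of `(κ + ∂)^(-1/2)`, with the same choice of power. -/
def symPlus (κ ξ : ℝ) : ℂ := ((κ : ℂ) + 2 * π * ξ * Complex.I) ^ (-(1 / 2) : ℂ)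

/-- `T` is the bounded operator `a(D) w b(D)` on `L²(ℝ)`: here `a(D)` and `b(D)` are Fourier
multipliers, and `w` stands for multiplication by the distribution `w`. It is tested on those
`f, g ∈ L²` for which `u = a(D)^* f` and `v = b(D) g` are Schwartz functions, where it says
`⟨f, T g⟩ = ⟨u, w v⟩ = w(ū v)`. -/
def IsSandwich (a b : ℝ → ℂ) (w : 𝓢'(ℝ, ℂ)) (T : L2 →L[ℂ] L2) : Prop :=
  ∀ (f g : L2) (u v p : 𝓢(ℝ, ℂ)),
    (∀ᵐ ξ : ℝ, 𝓕 u ξ = conj (a ξ) * (𝓕 f : L2) ξ) →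
    (∀ᵐ ξ : ℝ, 𝓕 v ξ = b ξ * (𝓕 g : L2) ξ) →
    (∀ x, p x = conj (u x) * v x) →
    ⟪f, T g⟫_ℂ = w p

open Classical in
/-- The bounded operator `a(D) w b(D)` on `L²(ℝ)` (set to `0` if there is none). -/
def sandwich (a b : ℝ → ℂ) (w : 𝓢'(ℝ, ℂ)) : L2 →L[ℂ] L2 :=
  if h : ∃ T, IsSandwich a b w T then h.choose else 0

/-- `Λ = (κ - ∂)^(-1/2) q (κ + ∂)^(-1/2)`. -/
def Lam (κ : ℝ) (q : 𝓢'(ℝ, ℂ)) : L2 →L[ℂ] L2 :=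
  sandwich (symMinus κ) (symPlus κ) q

/-- `Γ = (κ + ∂)^(-1/2) r (κ - ∂)^(-1/2)`, where `r = ± q̄`. -/
def Gam (ε κ : ℝ) (q : 𝓢'(ℝ, ℂ)) : L2 →L[ℂ] L2 :=
  sandwich (symPlus κ) (symMinus κ) (companion ε q)

/-! ### Traces and the logarithmic perturbation determinant -/

/-- The bounded operator `T` is of trace class with trace `c`: for every orthonormal basis `b` the
series `∑ ⟨b i, T (b i)⟩` converges (unconditionally, hence absolutely) to `c`. -/
def HasTrace (T : L2 →L[ℂ] L2) (c : ℂ) : Prop :=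
  ∀ (ι : Type) (b : HilbertBasis ι ℂ L2), HasSum (fun i => ⟪b i, T (b i)⟫_ℂ) c

open Classical in
/-- The trace of a trace class operator (set to `0` for other operators). -/
def tr (T : L2 →L[ℂ] L2) : ℂ := if h : ∃ c, HasTrace T c then h.choose else 0

/-- The summand of index `m + 1` in the series `∑_{m ≥ 1} (-1)^(m-1) / m tr ((ΛΓ)^m)`. -/
def logDetTerm (ε κ : ℝ) (q : 𝓢'(ℝ, ℂ)) (m : ℕ) : ℂ :=
  (-1) ^ m / ((m : ℂ) + 1) * tr ((Lam κ q * Gam ε κ q) ^ (m + 1))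

/-- `A(κ; q) = sgn(κ) ∑_{m ≥ 1} (-1)^(m-1) / m tr ((ΛΓ)^m)`. -/
def A (ε κ : ℝ) (q : 𝓢'(ℝ, ℂ)) : ℂ := (Real.sign κ : ℂ) * ∑' m : ℕ, logDetTerm ε κ q m

/-- `A(κ; q)` is well defined: `Λ` and `Γ` are bounded operators on `L²(ℝ)`, all `(ΛΓ)^m` with
`m ≥ 1` are of trace class, and the series of their traces converges absolutely. -/
def ADefined (ε κ : ℝ) (q : 𝓢'(ℝ, ℂ)) : Prop :=
  (∃ T, IsSandwich (symMinus κ) (symPlus κ) q T) ∧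
  (∃ T, IsSandwich (symPlus κ) (symMinus κ) (companion ε q) T) ∧
  (∀ m : ℕ, ∃ c, HasTrace ((Lam κ q * Gam ε κ q) ^ (m + 1)) c) ∧
  Summable (fun m : ℕ => ‖logDetTerm ε κ q m‖)

/-- `α(κ; q) = ± Re A(κ; q)` for `κ ≥ 1`. -/
def alpha (ε κ : ℝ) (q : 𝓢'(ℝ, ℂ)) : ℝ := ε * (A ε κ q).re

/-! ### Hamiltonian flows on Schwartz space -/

/-- `Fq = δF/δq` and `Fr = δF/δr` are the functional derivatives of `F` at `q`:
`d/dθ F(q + θ f) = ∫ f (δF/δq) dx ± ∫ f̄ (δF/δr) dx` at `θ = 0`, for all `f`. -/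
def HasFunctionalDerivs (ε : ℝ) (F : 𝓢(ℝ, ℂ) → ℝ) (q Fq Fr : 𝓢(ℝ, ℂ)) : Prop :=
  ∀ f : 𝓢(ℝ, ℂ), HasDerivAt (fun θ : ℝ => ((F (q + θ • f) : ℝ) : ℂ))
    ((∫ x : ℝ, f x * Fq x) + (ε : ℂ) * ∫ x : ℝ, conj (f x) * Fr x) 0

/-- `t ↦ q(t)` is, on the time interval `J`, an orbit in Schwartz space of the flow of the
Hamiltonian `H`: it solves `i dq/dt = δH/δr`. -/
def IsHamiltonianOrbit (ε : ℝ) (H : 𝓢(ℝ, ℂ) → ℝ) (J : Set ℝ) (q : ℝ → 𝓢(ℝ, ℂ)) : Prop :=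
  ∀ t ∈ J, ∃ Hq Hr q' : 𝓢(ℝ, ℂ), HasFunctionalDerivs ε H (q t) Hq Hr ∧
    HasDerivWithinAt q q' J t ∧ Complex.I • q' = Hr

/-- `A(ϰ)` is conserved along `t ↦ q(t)`, `t ∈ J`, for all real `|ϰ| ≥ 1`: it keeps its value at
time `0` for as long as it remains defined. -/
def ConservesA (ε : ℝ) (J : Set ℝ) (q : ℝ → 𝓢(ℝ, ℂ)) : Prop :=
  ∀ ϰ : ℝ, 1 ≤ |ϰ| → ∀ t ∈ J, (∀ τ ∈ uIcc 0 t, ADefined ε ϰ (q τ : 𝓢'(ℝ, ℂ))) →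
    A ε ϰ (q t : 𝓢'(ℝ, ℂ)) = A ε ϰ (q 0 : 𝓢'(ℝ, ℂ))

end AKNS

end

/-! On the frequency side `Λ` is the integral operator with kernel `a(ξ) q̂(ξ - η) b(η)`, where
`|a|²` and `|b|²` are `(ϰ² + ·²)^(-1/2)`, and `Γ` is up to sign the adjoint of an operator of the
same kind. Integrating over `η` with `ζ = ξ - η` fixed bounds both squared Hilbert-Schmidt norms by
`N = D |ϰ|^(-1-2s) ‖q‖²`, with the `H^s_|ϰ|` norm (`exists_hilbertSchmidt_bound`). So `ΛΓ` is a
product of two Hilbert-Schmidt operators, `|tr (ΛΓ)^m| ≤ N^m`, and for small `q` the series is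
dominated by a geometric one.

The term `m = 1` is explicit: it contributes `∫ |q̂|² 2ϰ / (4ϰ² + ξ²)` to `α`
(`integral_symbol_mul`, `Factorization.traceValue_zero`). Integrated against `ϰ^(2s) dϰ` over `(κ,
∞)`, this weight becomes comparable to `(4κ² + ξ²)^s` (`exists_energy_bounds`), so the leading term
alone is comparable to the squared norm. The terms `m ≥ 2` are at most `N²`; weighted by `ϰ^(2s)`
they decay like `ϰ^(-2-2s)`, which is integrable because `s > -1/2`, and their integral is quadratic
in the squared norm. On a small ball it is absorbed (`energy_estimate`).

For an orbit, conservation of `A` makes the energy integrals at times `0` and `t` equal, so the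
two-sided estimate compares the norms, as long as the orbit has stayed in the ball where the
estimate holds. Starting in a smaller ball, a continuity argument (`le_of_bootstrap`) shows that it
never leaves. -/

open MeasureTheory FourierTransform Set
open scoped SchwartzMap ComplexConjugate InnerProductSpace Real
noncomputable section
namespace AKNS

/-! ### Operators on `L²` given by square integrable families of rows -/

/-- `T f = ⟪k ·, f⟫` almost everywhere: `k` is the family of rows of `T`. -/
def HasRows {E : Type*} [NormedAddCommGroup E] [InnerProductSpace ℂ E]
    (T : E →L[ℂ] L2) (k : ℝ → E) : Prop :=
  ∀ f, (T f : ℝ → ℂ) =ᵐ[volume] fun η => ⟪k η, f⟫_ℂ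

instance : TopologicalSpace.SeparableSpace L2 := by
  have : Fact ((2 : ENNReal) ≠ ⊤) := ⟨by simp⟩
  have : SecondCountableTopology L2 := Lp.SecondCountableTopology
  infer_instance

/-- Basis vectors lie at distance `√2`, so balls of radius `1/2` around them are disjoint open sets
in a separable space. Since `HasTrace` ranges over all bases, this is what allows a.e. statements to
hold for all basis vectors at once. -/
lemma hilbertBasis_countable {ι : Type*} (b : HilbertBasis ι ℂ L2) : Countable ι := by
  have hdist : ∀ i j, i ≠ j → 1 ≤ dist (b i) (b j) := by
    intro i j hij
    have h1 : ‖b i - b j‖ ^ 2 = 2 := by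
      have h := @norm_sub_sq ℂ _ _ _ _ (b i) (b j)
      rw [b.orthonormal.2 hij, b.orthonormal.1 i, b.orthonormal.1 j] at h
      rw [h]; norm_num
    rw [dist_eq_norm]
    nlinarith [norm_nonneg (b i - b j)]
  refine Pairwise.countable_of_isOpen_disjoint (s := fun i => Metric.ball (b i) (1 / 2)) ?_
    (fun i => Metric.isOpen_ball) (fun i => ⟨b i, by simp⟩)
  intro i j hij
  exact Metric.ball_disjoint_ball (by linarith [hdist i j hij])

lemma hilbertBasis_hasSum_sq {E : Type*} [NormedAddCommGroup E] [InnerProductSpace ℂ E]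
    [CompleteSpace E] {ι : Type*} (b : HilbertBasis ι ℂ E) (x : E) :
    HasSum (fun i => ‖⟪x, b i⟫_ℂ‖ ^ 2) (‖x‖ ^ 2) := by
  have h := (b.hasSum_inner_mul_inner x x).mapL Complex.reCLM
  convert! h using 1
  · funext i
    rw [← inner_conj_symm (b i) x, Complex.mul_conj, Complex.reCLM_apply, Complex.ofReal_re,
      Complex.normSq_eq_norm_sq]
  · simp [inner_self_eq_norm_sq_to_K, ← Complex.ofReal_pow]

/-- Parseval holds pointwise in `η`; summation and integration are exchanged by dominated
convergence, the majorant coming from `2xy ≤ x² + y²` and Bessel sums of the rows. -/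
theorem hasSum_inner_of_hasRows {E : Type*} [NormedAddCommGroup E] [InnerProductSpace ℂ E]
    [CompleteSpace E] {S T : E →L[ℂ] L2} {l k : ℝ → E} (hS : HasRows S l) (hT : HasRows T k)
    (hl : Integrable fun η => ‖l η‖ ^ 2) (hk : Integrable fun η => ‖k η‖ ^ 2)
    {ι : Type*} [Countable ι] (b : HilbertBasis ι ℂ E) :
    HasSum (fun i => ⟪S (b i), T (b i)⟫_ℂ) (∫ η, ⟪k η, l η⟫_ℂ) := by
  have hsum : ∀ η, HasSum (fun i => (‖⟪k η, b i⟫_ℂ‖ ^ 2 + ‖⟪l η, b i⟫_ℂ‖ ^ 2) / 2)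
      ((‖k η‖ ^ 2 + ‖l η‖ ^ 2) / 2) := fun η =>
    ((hilbertBasis_hasSum_sq b (k η)).add (hilbertBasis_hasSum_sq b (l η))).div_const 2
  have h := hasSum_integral_of_dominated_convergence (μ := (volume : Measure ℝ))
    (F := fun i η => ⟪(S (b i) : ℝ → ℂ) η, (T (b i) : ℝ → ℂ) η⟫_ℂ)
    (f := fun η => ⟪k η, l η⟫_ℂ)
    (fun i η => (‖⟪k η, b i⟫_ℂ‖ ^ 2 + ‖⟪l η, b i⟫_ℂ‖ ^ 2) / 2)
    (fun i => (Lp.aestronglyMeasurable _).inner (Lp.aestronglyMeasurable _))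
    (fun i => by
      filter_upwards [hS (b i), hT (b i)] with η h1 h2
      rw [h1, h2]
      refine (norm_inner_le_norm _ _).trans ?_
      nlinarith [sq_nonneg (‖⟪l η, b i⟫_ℂ‖ - ‖⟪k η, b i⟫_ℂ‖)])
    (ae_of_all _ fun η => (hsum η).summable)
    (by simp_rw [fun η => (hsum η).tsum_eq]; exact (hk.add hl).div_const 2)
    (by
      have hc : ∀ᵐ η : ℝ, ∀ i, (S (b i) : ℝ → ℂ) η = ⟪l η, b i⟫_ℂ ∧
          (T (b i) : ℝ → ℂ) η = ⟪k η, b i⟫_ℂ := by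
        rw [ae_all_iff]
        intro i
        filter_upwards [hS (b i), hT (b i)] with η h1 h2 using ⟨h1, h2⟩
      filter_upwards [hc] with η hη
      convert! b.hasSum_inner_mul_inner (k η) (l η) using 1
      funext i
      rw [(hη i).1, (hη i).2, RCLike.inner_apply, inner_conj_symm])
  exact h

lemma norm_sq_L2 (f : L2) : ‖f‖ ^ 2 = ∫ x, ‖f x‖ ^ 2 := by
  have h := (@inner_self_eq_norm_sq_to_K ℂ _ _ _ _ f)
  rw [L2.inner_def] at h
  simp_rw [inner_self_eq_norm_sq_to_K] at h
  norm_cast at h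
  exact h.symm

/-- The Hilbert-Schmidt norm dominates the operator norm. -/
lemma HasRows.norm_le {E : Type*} [NormedAddCommGroup E] [InnerProductSpace ℂ E]
    {T : E →L[ℂ] L2} {k : ℝ → E} (hT : HasRows T k) (hk : Integrable fun η => ‖k η‖ ^ 2)
    {M : ℝ} (hM : 0 ≤ M) (h : ∫ η, ‖k η‖ ^ 2 ≤ M ^ 2) : ‖T‖ ≤ M := by
  refine ContinuousLinearMap.opNorm_le_bound _ hM fun f => ?_
  refine le_of_sq_le_sq ?_ (by positivity)
  rw [norm_sq_L2]
  calc ∫ x, ‖T f x‖ ^ 2 ≤ ∫ x, ‖k x‖ ^ 2 * ‖f‖ ^ 2 := by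
        refine integral_mono_of_nonneg (ae_of_all _ fun x => by positivity) (hk.mul_const _) ?_
        filter_upwards [hT f] with x hx
        rw [hx, ← mul_pow]
        gcongr
        exact norm_inner_le_norm _ _
    _ = (∫ x, ‖k x‖ ^ 2) * ‖f‖ ^ 2 := integral_mul_const _ _
    _ ≤ (M * ‖f‖) ^ 2 := by rw [mul_pow]; gcongr

theorem exists_hasRows {E : Type*} [NormedAddCommGroup E] [InnerProductSpace ℂ E]
    {k : ℝ → E} (hm : ∀ f, AEStronglyMeasurable (fun η => ⟪k η, f⟫_ℂ) volume)
    (hk : Integrable fun η => ‖k η‖ ^ 2) : ∃ T : E →L[ℂ] L2, HasRows T k := by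
  have hmem : ∀ f, MemLp (fun η => ⟪k η, f⟫_ℂ) 2 volume := by
    intro f
    rw [memLp_two_iff_integrable_sq_norm (hm f)]
    refine (hk.mul_const (‖f‖ ^ 2)).mono' ((hm f).norm.pow 2) (ae_of_all _ fun x => ?_)
    rw [Real.norm_of_nonneg (by positivity), ← mul_pow]
    gcongr
    exact norm_inner_le_norm _ _
  let T₀ : E →ₗ[ℂ] L2 :=
    { toFun := fun f => (hmem f).toLp
      map_add' := fun f g => by
        rw [← MemLp.toLp_add]
        exact MemLp.toLp_congr _ _ (ae_of_all _ fun x => by simp)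
      map_smul' := fun c f => by
        rw [RingHom.id_apply, ← MemLp.toLp_const_smul]
        exact MemLp.toLp_congr _ _ (ae_of_all _ fun x => by simp) }
  refine ⟨T₀.mkContinuous (Real.sqrt (∫ η, ‖k η‖ ^ 2)) fun f => ?_, fun f => ?_⟩
  · refine le_of_sq_le_sq ?_ (by positivity)
    rw [norm_sq_L2, mul_pow, Real.sq_sqrt (integral_nonneg fun x => by positivity),
      ← integral_mul_const]
    refine integral_mono_of_nonneg (ae_of_all _ fun x => by positivity) (hk.mul_const _) ?_
    filter_upwards [(hmem f).coeFn_toLp] with x hx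
    change ‖((hmem f).toLp : ℝ → ℂ) x‖ ^ 2 ≤ _
    rw [hx, ← mul_pow]
    gcongr
    exact norm_inner_le_norm _ _
  · exact (hmem f).coeFn_toLp

lemma HasRows.comp {E E' : Type*} [NormedAddCommGroup E] [InnerProductSpace ℂ E] [CompleteSpace E]
    [NormedAddCommGroup E'] [InnerProductSpace ℂ E'] [CompleteSpace E']
    {T : E →L[ℂ] L2} {k : ℝ → E} (hT : HasRows T k) (S : E' →L[ℂ] E) :
    HasRows (T ∘L S) fun η => S.adjoint (k η) := by
  intro f
  filter_upwards [hT (S f)] with η hη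
  rw [ContinuousLinearMap.comp_apply, hη, ContinuousLinearMap.adjoint_inner_left]

/-- Only the pairings of `k` with fixed vectors are known to be measurable; `‖k‖²` inherits
measurability as the limit of its finite Parseval sums. -/
lemma integrable_norm_sq_of_weak {E : Type*} [NormedAddCommGroup E] [InnerProductSpace ℂ E]
    [CompleteSpace E] {ι : Type*} [Countable ι] (b : HilbertBasis ι ℂ E) {k : ℝ → E} {φ : ℝ → ℝ}
    (hm : ∀ f, AEStronglyMeasurable (fun η => ⟪k η, f⟫_ℂ) volume)
    (hφ : Integrable φ) (h : ∀ᵐ η, ‖k η‖ ^ 2 ≤ φ η) : Integrable fun η => ‖k η‖ ^ 2 := by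
  refine hφ.mono' ?_ ?_
  · refine aestronglyMeasurable_of_tendsto_ae Filter.atTop
      (f := fun s : Finset ι => fun η => ∑ i ∈ s, ‖⟪k η, b i⟫_ℂ‖ ^ 2) (fun s => ?_)
      (ae_of_all _ fun η => hilbertBasis_hasSum_sq b (k η))
    exact Finset.aestronglyMeasurable_fun_sum s fun i _ => (hm (b i)).norm.pow 2
  · filter_upwards [h] with η hη
    rwa [Real.norm_of_nonneg (by positivity)]

lemma HasRows.integrable_comp {T : L2 →L[ℂ] L2} {k : ℝ → L2} (hT : HasRows T k)
    (hk : Integrable fun η => ‖k η‖ ^ 2) (S : L2 →L[ℂ] L2) :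
    Integrable fun η => ‖S.adjoint (k η)‖ ^ 2 := by
  obtain ⟨w, b, -⟩ := exists_hilbertBasis ℂ L2
  have := hilbertBasis_countable b
  refine integrable_norm_sq_of_weak b (φ := fun η => ‖S‖ ^ 2 * ‖k η‖ ^ 2) (fun f => ?_)
    (hk.const_mul _) (ae_of_all _ fun η => ?_)
  · exact (Lp.aestronglyMeasurable (T (S f))).congr (hT.comp S f)
  · rw [← mul_pow]
    gcongr
    simpa using S.adjoint.le_opNorm (k η)

/-- Trace formula for `S† T X` when `S` and `T` have square integrable families of rows. -/
theorem hasTrace_of_hasRows {S T : L2 →L[ℂ] L2} {l k : ℝ → L2} (hS : HasRows S l)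
    (hT : HasRows T k) (hl : Integrable fun η => ‖l η‖ ^ 2) (hk : Integrable fun η => ‖k η‖ ^ 2)
    (X : L2 →L[ℂ] L2) :
    HasTrace (S.adjoint * (T * X)) (∫ η, ⟪X.adjoint (k η), l η⟫_ℂ) := by
  intro ι b
  have := hilbertBasis_countable b
  have h := hasSum_inner_of_hasRows hS (hT.comp X) hl (hT.integrable_comp hk X) b
  simpa [ContinuousLinearMap.adjoint_inner_right] using h

lemma norm_integral_inner_le {l k : ℝ → L2} (hl : Integrable fun η => ‖l η‖ ^ 2)
    (hk : Integrable fun η => ‖k η‖ ^ 2) {N : ℝ} (hl' : ∫ η, ‖l η‖ ^ 2 ≤ N)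
    (hk' : ∫ η, ‖k η‖ ^ 2 ≤ N) (X : L2 →L[ℂ] L2) :
    ‖∫ η, ⟪X.adjoint (k η), l η⟫_ℂ‖ ≤ ‖X‖ * N := by
  have h : ‖∫ η, ⟪X.adjoint (k η), l η⟫_ℂ‖ ≤ ∫ η, ‖X‖ * ((‖l η‖ ^ 2 + ‖k η‖ ^ 2) / 2) := by
    refine norm_integral_le_of_norm_le (((hl.add hk).div_const 2).const_mul _)
      (ae_of_all _ fun η => ?_)
    refine (norm_inner_le_norm _ _).trans ?_
    have h1 : ‖X.adjoint (k η)‖ ≤ ‖X‖ * ‖k η‖ := by simpa using X.adjoint.le_opNorm (k η)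
    calc ‖X.adjoint (k η)‖ * ‖l η‖ ≤ ‖X‖ * ‖k η‖ * ‖l η‖ := by gcongr
      _ = ‖X‖ * (‖k η‖ * ‖l η‖) := by ring
      _ ≤ ‖X‖ * ((‖l η‖ ^ 2 + ‖k η‖ ^ 2) / 2) := by
        gcongr
        nlinarith [sq_nonneg (‖l η‖ - ‖k η‖)]
  refine h.trans ?_
  rw [integral_const_mul, integral_div, integral_add hl hk]
  gcongr
  linarith

lemma HasTrace.tr_eq {T : L2 →L[ℂ] L2} {c : ℂ} (h : HasTrace T c) : tr T = c := by
  have hex : ∃ c, HasTrace T c := ⟨c, h⟩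
  rw [tr, dif_pos hex]
  obtain ⟨w, b, -⟩ := exists_hilbertBasis ℂ L2
  exact (hex.choose_spec _ b).unique (h _ b)

/-! ### Square integrable kernels -/

open Classical in
/-- The row `K η ·` of a kernel as an element of `L²` (zero if it is not square integrable). -/
def rows (K : ℝ → ℝ → ℂ) (η : ℝ) : L2 :=
  if h : MemLp (K η) 2 (volume : Measure ℝ) then h.toLp else 0

lemma coeFn_rows {K : ℝ → ℝ → ℂ} {η : ℝ} (h : MemLp (K η) 2 volume) :
    (rows K η : ℝ → ℂ) =ᵐ[volume] K η := by
  rw [rows, dif_pos h]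
  exact h.coeFn_toLp

lemma inner_rows {K : ℝ → ℝ → ℂ} {η : ℝ} (h : MemLp (K η) 2 volume) (f : L2) :
    ⟪rows K η, f⟫_ℂ = ∫ ξ, conj (K η ξ) * f ξ := by
  rw [L2.inner_def]
  refine integral_congr_ae ?_
  filter_upwards [coeFn_rows h] with ξ hξ
  rw [hξ, RCLike.inner_apply, mul_comm]

lemma inner_rows_rows {K M : ℝ → ℝ → ℂ} {η : ℝ} (h : MemLp (K η) 2 volume)
    (h' : MemLp (M η) 2 volume) : ⟪rows K η, rows M η⟫_ℂ = ∫ ξ, conj (K η ξ) * M η ξ := by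
  rw [inner_rows h]
  refine integral_congr_ae ?_
  filter_upwards [coeFn_rows h'] with ξ hξ
  rw [hξ]

lemma norm_sq_rows {K : ℝ → ℝ → ℂ} {η : ℝ} (h : MemLp (K η) 2 volume) :
    ‖rows K η‖ ^ 2 = ∫ ξ, ‖K η ξ‖ ^ 2 := by
  rw [norm_sq_L2]
  refine integral_congr_ae ?_
  filter_upwards [coeFn_rows h] with ξ hξ
  rw [hξ]

lemma ae_memLp_row {K : ℝ → ℝ → ℂ} (hK : Measurable (Function.uncurry K)) {N : ℝ}
    (hN : ∫⁻ η, ∫⁻ ξ, ‖K η ξ‖ₑ ^ 2 ≤ ENNReal.ofReal N) :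
    ∀ᵐ η, MemLp (K η) 2 (volume : Measure ℝ) := by
  have hm : Measurable fun η => ∫⁻ ξ, ‖K η ξ‖ₑ ^ 2 :=
    Measurable.lintegral_prod_right' (f := fun p : ℝ × ℝ => ‖K p.1 p.2‖ₑ ^ 2)
      (hK.enorm.pow_const 2)
  filter_upwards [ae_lt_top hm (ne_top_of_le_ne_top ENNReal.ofReal_ne_top hN)] with η hη
  have hKη : Measurable (K η) := hK.comp measurable_prodMk_left
  rw [memLp_two_iff_integrable_sq_norm hKη.aestronglyMeasurable]
  refine ⟨(hKη.norm.pow_const 2).aestronglyMeasurable, ?_⟩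
  rw [HasFiniteIntegral]
  refine lt_of_eq_of_lt (lintegral_congr fun ξ => ?_) hη
  rw [enorm_pow, enorm_norm]

lemma integrable_kernel_sq {K : ℝ → ℝ → ℂ} (hK : Measurable (Function.uncurry K)) {N : ℝ}
    (hN : ∫⁻ η, ∫⁻ ξ, ‖K η ξ‖ₑ ^ 2 ≤ ENNReal.ofReal N) :
    Integrable fun p : ℝ × ℝ => ‖K p.1 p.2‖ ^ 2 := by
  refine ⟨(hK.norm.pow_const 2).aestronglyMeasurable, ?_⟩
  rw [HasFiniteIntegral, Measure.volume_eq_prod,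
    lintegral_prod _ (by exact (hK.norm.pow_const 2).enorm.aemeasurable)]
  refine lt_of_le_of_lt (le_of_eq_of_le ?_ hN) ENNReal.ofReal_lt_top
  refine lintegral_congr fun η => lintegral_congr fun ξ => ?_
  rw [enorm_pow, enorm_norm]

lemma integrable_norm_sq_rows {K : ℝ → ℝ → ℂ} (hK : Measurable (Function.uncurry K)) {N : ℝ}
    (hN : ∫⁻ η, ∫⁻ ξ, ‖K η ξ‖ₑ ^ 2 ≤ ENNReal.ofReal N) :
    Integrable fun η => ‖rows K η‖ ^ 2 := by
  have h := (integrable_kernel_sq hK hN).integral_prod_left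
  refine h.congr ?_
  filter_upwards [ae_memLp_row hK hN] with η hη
  rw [norm_sq_rows hη]

lemma integral_norm_sq_rows_le {K : ℝ → ℝ → ℂ} (hK : Measurable (Function.uncurry K)) {N : ℝ}
    (hN : ∫⁻ η, ∫⁻ ξ, ‖K η ξ‖ₑ ^ 2 ≤ ENNReal.ofReal N)
    (hN0 : 0 ≤ N) : ∫ η, ‖rows K η‖ ^ 2 ≤ N := by
  have h : ∫ η, ‖rows K η‖ ^ 2 = ∫ p : ℝ × ℝ, ‖K p.1 p.2‖ ^ 2 := by
    rw [Measure.volume_eq_prod, integral_prod _ (integrable_kernel_sq hK hN)]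
    refine integral_congr_ae ?_
    filter_upwards [ae_memLp_row hK hN] with η hη
    rw [norm_sq_rows hη]
  have hsq : Measurable fun p : ℝ × ℝ => ‖K p.1 p.2‖ ^ 2 := hK.norm.pow_const 2
  rw [h, integral_eq_lintegral_of_nonneg_ae (ae_of_all _ fun p => by positivity)
    hsq.aestronglyMeasurable]
  refine ENNReal.toReal_le_of_le_ofReal hN0 (le_of_eq_of_le ?_ hN)
  rw [Measure.volume_eq_prod, lintegral_prod _ hsq.ennreal_ofReal.aemeasurable]
  refine lintegral_congr fun η => lintegral_congr fun ξ => ?_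
  rw [ENNReal.ofReal_pow (norm_nonneg _), ofReal_norm]

lemma aestronglyMeasurable_inner_rows {K : ℝ → ℝ → ℂ} (hK : Measurable (Function.uncurry K)) {N : ℝ}
    (hN : ∫⁻ η, ∫⁻ ξ, ‖K η ξ‖ₑ ^ 2 ≤ ENNReal.ofReal N)
    (f : L2) :
    AEStronglyMeasurable (fun η => ⟪rows K η, f⟫_ℂ) volume := by
  have h : StronglyMeasurable fun η => ∫ ξ, conj (K η ξ) * f ξ := by
    refine StronglyMeasurable.integral_prod_right' (f := fun p : ℝ × ℝ =>
      conj (K p.1 p.2) * f p.2) ?_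
    have := (Lp.stronglyMeasurable f).measurable
    refine Measurable.stronglyMeasurable ?_
    exact (Complex.continuous_conj.measurable.comp hK).mul (this.comp measurable_snd)
  refine h.aestronglyMeasurable.congr ?_
  filter_upwards [ae_memLp_row hK hN] with η hη
  rw [inner_rows hη]

theorem exists_hasRows_rows {K : ℝ → ℝ → ℂ} (hK : Measurable (Function.uncurry K)) {N : ℝ}
    (hN : ∫⁻ η, ∫⁻ ξ, ‖K η ξ‖ₑ ^ 2 ≤ ENNReal.ofReal N) :
    ∃ T : L2 →L[ℂ] L2, HasRows T (rows K) :=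
  exists_hasRows (aestronglyMeasurable_inner_rows hK hN) (integrable_norm_sq_rows hK hN)

/-! ### Sandwiches on the frequency side -/

lemma fourier_conj_shift (u : 𝓢(ℝ, ℂ)) (ζ x : ℝ) :
    𝓕 (fun η : ℝ => conj (𝓕 u (ζ + η))) x
      = Complex.exp ((2 * π * x * ζ : ℝ) * Complex.I) * conj (u x) := by
  have hinv : u x = 𝓕⁻ (𝓕 u) x := by rw [fourierInv_fourier_eq]
  rw [SchwartzMap.fourierInv_coe, Real.fourierInv_eq'] at hinv
  rw [Real.fourier_eq', ← integral_sub_right_eq_self _ ζ, hinv, ← integral_conj,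
    ← integral_const_mul]
  congr 1
  funext η
  rw [smul_eq_mul, smul_eq_mul, map_mul, ← Complex.exp_conj, ← mul_assoc, ← Complex.exp_add,
    add_sub_cancel]
  congr 2
  simp only [map_mul, Complex.conj_ofReal, Complex.conj_I, RCLike.inner_apply, conj_trivial]
  push_cast
  ring

/-- A convolution theorem: moving the Fourier transform from `v` to the translate of `conj û` turns
the translation into a modulation of `conj u`. -/
lemma fourierInv_conj_mul (u v p : 𝓢(ℝ, ℂ)) (hp : ∀ x, p x = conj (u x) * v x) (ζ : ℝ) :
    𝓕⁻ p ζ = ∫ η : ℝ, conj (𝓕 u (ζ + η)) * 𝓕 v η := by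
  have hg : Integrable fun η : ℝ => conj (𝓕 u (ζ + η)) :=
    (((𝓕 u).integrable (μ := volume)).comp_add_left ζ).congr' (by
      have : Continuous fun η : ℝ => conj (𝓕 u (ζ + η)) :=
        Complex.continuous_conj.comp ((𝓕 u).continuous.comp (by fun_prop))
      exact this.aestronglyMeasurable) (ae_of_all _ fun η => by simp)
  have h := VectorFourier.integral_fourierIntegral_smul_eq_flip (L := innerₗ ℝ) (μ := volume)
    (ν := volume) Real.continuous_fourierChar continuous_inner (v.integrable (μ := volume)) hg
  simp only [smul_eq_mul, flip_innerₗ] at h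
  change ∫ η, 𝓕 (v : ℝ → ℂ) η * conj (𝓕 u (ζ + η)) =
    ∫ x, v x * 𝓕 (fun η : ℝ => conj (𝓕 u (ζ + η))) x at h
  rw [SchwartzMap.fourierInv_coe, Real.fourierInv_eq']
  simp_rw [mul_comm (conj _) (𝓕 v _), SchwartzMap.fourier_coe v]
  rw [h]
  congr 1
  funext x
  rw [fourier_conj_shift, hp, smul_eq_mul]
  simp only [RCLike.inner_apply, conj_trivial]
  push_cast
  ring_nf

lemma schwartz_inv_quadratic_bound (u : 𝓢(ℝ, ℂ)) :
    ∃ C : ℝ, 0 < C ∧ ∀ x, ‖u x‖ ≤ C * (1 + x ^ 2)⁻¹ := by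
  obtain ⟨C₀, h₀, hC₀⟩ := u.decay 0 0
  obtain ⟨C₂, h₂, hC₂⟩ := u.decay 2 0
  refine ⟨C₀ + C₂, by positivity, fun x => ?_⟩
  have h1 := hC₀ x
  have h3 := hC₂ x
  simp only [norm_iteratedFDeriv_zero, pow_zero, one_mul, Real.norm_eq_abs, sq_abs] at h1 h3
  rw [← div_eq_mul_inv, le_div_iff₀ (by positivity)]
  nlinarith

lemma integrable_quadratic_mul (v : 𝓢(ℝ, ℂ)) :
    Integrable fun η : ℝ => ((1 + η ^ 2 : ℝ) : ℂ) * v η := by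
  have h := (v.integrable_pow_mul volume 0).add (v.integrable_pow_mul volume 2)
  refine h.mono' (by have := v.continuous; fun_prop) (ae_of_all _ fun η => le_of_eq ?_)
  rw [norm_mul, Complex.norm_real, Real.norm_of_nonneg (by positivity)]
  simp only [Pi.add_apply, Real.norm_eq_abs, sq_abs, pow_zero]
  ring

/-- Identifies the kernel form with the pairing of `q` against `ū v`. It is Fubini after the
substitution `ξ = ζ + η`. -/
lemma integral_convolution_eq {Q : ℝ → ℂ} (hQ : Measurable Q)
    (hQi : Integrable fun ζ : ℝ => (((1 + ζ ^ 2)⁻¹ : ℝ) : ℂ) * Q ζ)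
    (u v p : 𝓢(ℝ, ℂ)) (hp : ∀ x, p x = conj (u x) * v x) :
    ∫ η : ℝ, (∫ ξ : ℝ, Q (ξ - η) * conj (𝓕 u ξ)) * 𝓕 v η = ∫ ζ : ℝ, 𝓕⁻ p ζ * Q ζ := by
  obtain ⟨C, hC, hCu⟩ := schwartz_inv_quadratic_bound (𝓕 u)
  have hint : Integrable (Function.uncurry fun η ζ : ℝ =>
      (Q ζ * conj (𝓕 u (ζ + η))) * 𝓕 v η) (volume.prod volume) := by
    have h := ((integrable_quadratic_mul (𝓕 v)).mul_prod hQi).norm.const_mul (2 * C)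
    refine h.mono' ?_ (ae_of_all _ fun p => ?_)
    · have h1 : Measurable fun p : ℝ × ℝ => Q p.2 := hQ.comp measurable_snd
      have h2 : Measurable fun p : ℝ × ℝ => conj (𝓕 u (p.2 + p.1)) :=
        (Complex.continuous_conj.comp ((𝓕 u).continuous.comp (by fun_prop))).measurable
      have h3 : Measurable fun p : ℝ × ℝ => 𝓕 v p.1 :=
        ((𝓕 v).continuous.comp continuous_fst).measurable
      exact ((h1.mul h2).mul h3).aestronglyMeasurable
    · obtain ⟨η, ζ⟩ := p
      simp only [Function.uncurry_apply_pair, norm_mul, RCLike.norm_conj, Complex.norm_real]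
      rw [Real.norm_of_nonneg (show 0 ≤ 1 + η ^ 2 by positivity),
        Real.norm_of_nonneg (show 0 ≤ (1 + ζ ^ 2)⁻¹ by positivity)]
      have h1 : ‖𝓕 u (ζ + η)‖ ≤ 2 * C * (1 + η ^ 2) * (1 + ζ ^ 2)⁻¹ := by
        refine (hCu _).trans ?_
        rw [← div_eq_mul_inv, ← div_eq_mul_inv, div_le_div_iff₀ (by positivity) (by positivity)]
        -- Peetre's inequality: the decay of `û` at `ζ + η` is traded for decay in `ζ`, which makes
        -- `Q` integrable, and growth in `η`, which `𝓕 v` absorbs.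
        have : 1 + ζ ^ 2 ≤ 2 * ((1 + η ^ 2) * (1 + (ζ + η) ^ 2)) := by
          nlinarith [sq_nonneg (ζ + 2 * η), sq_nonneg (η * (ζ + η)), sq_nonneg ζ, sq_nonneg η]
        nlinarith
      calc ‖Q ζ‖ * ‖𝓕 u (ζ + η)‖ * ‖𝓕 v η‖
          ≤ ‖Q ζ‖ * (2 * C * (1 + η ^ 2) * (1 + ζ ^ 2)⁻¹) * ‖𝓕 v η‖ := by gcongr
        _ = _ := by ring
  calc ∫ η : ℝ, (∫ ξ : ℝ, Q (ξ - η) * conj (𝓕 u ξ)) * 𝓕 v η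
      = ∫ η : ℝ, ∫ ζ : ℝ, (Q ζ * conj (𝓕 u (ζ + η))) * 𝓕 v η := by
        congr 1
        funext η
        rw [integral_mul_const, ← integral_add_right_eq_self _ η]
        simp
    _ = ∫ ζ : ℝ, ∫ η : ℝ, (Q ζ * conj (𝓕 u (ζ + η))) * 𝓕 v η := integral_integral_swap hint
    _ = ∫ ζ : ℝ, 𝓕⁻ p ζ * Q ζ := by
        congr 1
        funext ζ
        rw [fourierInv_conj_mul u v p hp, mul_comm, ← integral_const_mul]
        simp_rw [mul_assoc]

/-- The kernel `(η, ξ) ↦ a ξ Q (ξ - η) b η`. -/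
def sandwichKernel (a b Q : ℝ → ℂ) (η ξ : ℝ) : ℂ := a ξ * Q (ξ - η) * b η

/-- The Fourier transform on `L²` as a continuous linear map. -/
def fourierL2 : L2 →L[ℂ] L2 := (Lp.fourierTransformₗᵢ ℝ ℂ).toContinuousLinearEquiv

lemma fourierL2_apply (f : L2) : fourierL2 f = 𝓕 f := rfl

/-- If `G` has the rows of the sandwich kernel, then `(G 𝓕)† 𝓕 = a(D) q b(D)`. -/
theorem isSandwich_of_hasRows {a b Q : ℝ → ℂ}
    (hQ : Measurable Q) (hQi : Integrable fun ζ : ℝ => (((1 + ζ ^ 2)⁻¹ : ℝ) : ℂ) * Q ζ)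
    {q : 𝓢'(ℝ, ℂ)} (hq : ∀ p : 𝓢(ℝ, ℂ), q p = ∫ ζ, 𝓕⁻ p ζ * Q ζ)
    (hmem : ∀ᵐ η, MemLp (sandwichKernel a b Q η) 2 volume)
    {G : L2 →L[ℂ] L2} (hG : HasRows G (rows (sandwichKernel a b Q))) :
    IsSandwich a b q ((G * fourierL2).adjoint * fourierL2) := by
  intro f g u v p hu hv hp
  -- Rows enter the inner product conjugated, so `G` integrates against the conjugate kernel and its
  -- adjoint against the kernel itself. This is why `G 𝓕` is moved to the left slot.
  rw [mul_apply_eq_comp, ContinuousLinearMap.adjoint_inner_right,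
    mul_apply_eq_comp, hq p, ← integral_convolution_eq hQ hQi u v p hp, L2.inner_def]
  refine integral_congr_ae ?_
  filter_upwards [hG (fourierL2 f), hv, hmem] with η h1 h2 h3
  rw [h1, inner_rows h3, RCLike.inner_apply, ← integral_conj, h2, fourierL2_apply,
    mul_comm ((𝓕 g : L2) η), ← mul_assoc]
  congr 1
  rw [← integral_mul_const]
  refine integral_congr_ae ?_
  filter_upwards [hu] with ξ hξ
  rw [fourierL2_apply, hξ, sandwichKernel]
  simp only [map_mul, Complex.conj_conj]
  ring

/-- Formally `b q̄ a` is the adjoint of `ā q b̄`. Hence `Γ` needs no kernel analysis of its own for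
`q̄`. -/
theorem isSandwich_companion {a b : ℝ → ℂ} {ε : ℝ} {q : 𝓢'(ℝ, ℂ)} {S : L2 →L[ℂ] L2}
    (hS : IsSandwich (fun ξ => conj (a ξ)) (fun ξ => conj (b ξ)) q S) :
    IsSandwich b a (companion ε q) ((ε : ℂ) • S.adjoint) := by
  intro f g u v p hu hv hp
  have h := hS g f v u (schwartzConj p) (by simpa using hv) hu (fun x => by
    simp [schwartzConj, hp, mul_comm])
  rw [smul_apply, inner_smul_right, ContinuousLinearMap.adjoint_inner_right,
    ← inner_conj_symm, h]
  rfl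

/-! ### Uniqueness of the sandwiched operator -/

lemma memLp_quadratic_mul (v : 𝓢(ℝ, ℂ)) :
    MemLp (fun η : ℝ => ((1 + η ^ 2 : ℝ) : ℂ) * v η) 2 volume := by
  have hg : Function.HasTemperateGrowth fun η : ℝ => ((1 + η ^ 2 : ℝ) : ℂ) := by fun_prop
  have h := (SchwartzMap.smulLeftCLM ℂ (fun η : ℝ => ((1 + η ^ 2 : ℝ) : ℂ)) v).memLp 2 volume
  rw [SchwartzMap.smulLeftCLM_apply hg] at h
  exact h

lemma exists_fourier_eq_mul {c : ℝ → ℂ} (hc : Measurable c) {C : ℝ}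
    (hcb : ∀ ξ, ‖c ξ‖ ≤ C * (1 + ξ ^ 2)) (u : 𝓢(ℝ, ℂ)) :
    ∃ f : L2, ∀ᵐ ξ : ℝ, (𝓕 f : L2) ξ = c ξ * 𝓕 u ξ := by
  have hm : MemLp (fun ξ => c ξ * 𝓕 u ξ) 2 volume := by
    refine (memLp_quadratic_mul (𝓕 u)).of_le_mul (c := C)
      (hc.mul (𝓕 u).continuous.measurable).aestronglyMeasurable (ae_of_all _ fun ξ => ?_)
    rw [norm_mul, norm_mul, Complex.norm_real, Real.norm_of_nonneg (by positivity), ← mul_assoc]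
    gcongr
    exact hcb ξ
  refine ⟨𝓕⁻ (hm.toLp), ?_⟩
  rw [fourier_fourierInv_eq]
  exact hm.coeFn_toLp

/-- The vectors `f` with `f̂ = c û` are total in `L²`: `û` may be any smooth compactly supported
function, so orthogonality forces `conj c · ĥ` to vanish as a distribution, and `c` has no zeros. -/
lemma eq_zero_of_orthogonal {c : ℝ → ℂ} (hc : Measurable c) {C : ℝ}
    (hcb : ∀ ξ, ‖c ξ‖ ≤ C * (1 + ξ ^ 2)) (hc0 : ∀ ξ, c ξ ≠ 0) {h : L2}
    (horth : ∀ (u : 𝓢(ℝ, ℂ)) (f : L2), (∀ᵐ ξ : ℝ, (𝓕 f : L2) ξ = c ξ * 𝓕 u ξ) → ⟪f, h⟫_ℂ = 0) :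
    h = 0 := by
  have hloc : LocallyIntegrable (fun ξ => conj (c ξ) * (𝓕 h : L2) ξ) volume := by
    have h1 : LocallyIntegrable (𝓕 h : L2) volume := (Lp.memLp _).locallyIntegrable (by simp)
    have h2 : LocallyIntegrable (fun ξ : ℝ => ((C * (1 + ξ ^ 2) : ℝ) : ℂ) * (𝓕 h : L2) ξ)
        volume := by
      rw [← locallyIntegrableOn_univ] at h1 ⊢
      exact h1.continuousOn_mul (by fun_prop) isClosed_univ.isLocallyClosed
    refine h2.mono ?_ (ae_of_all _ fun ξ => ?_)
    · exact (Complex.continuous_conj.measurable.comp hc).aestronglyMeasurable.mul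
        (Lp.aestronglyMeasurable _)
    · rw [norm_mul, norm_mul, RCLike.norm_conj]
      gcongr
      rw [Complex.norm_real]
      exact (hcb ξ).trans (le_abs_self _)
  have hae := ae_eq_zero_of_integral_contDiff_smul_eq_zero hloc (fun g hg hgc => by
    have hg₁ : HasCompactSupport (Complex.ofRealCLM ∘ g) := hgc.comp_left rfl
    have hg₂ : ContDiff ℝ (↑(⊤ : ℕ∞)) (Complex.ofRealCLM ∘ g) := by fun_prop
    obtain ⟨f, hf⟩ := exists_fourier_eq_mul hc hcb (𝓕⁻ (hg₁.toSchwartzMap hg₂))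
    have h0 := horth _ f hf
    rw [← Lp.inner_fourier_eq, L2.inner_def] at h0
    rw [← h0]
    refine integral_congr_ae ?_
    filter_upwards [hf] with ξ hξ
    rw [hξ, fourier_fourierInv_eq, RCLike.inner_apply, map_mul, Complex.real_smul]
    change _ = (𝓕 h : L2) ξ * (conj (c ξ) * conj ((g ξ : ℝ) : ℂ))
    rw [Complex.conj_ofReal]
    ring)
  have hz : (𝓕 h : L2) = 0 := by
    rw [Lp.eq_zero_iff_ae_eq_zero]
    filter_upwards [hae] with ξ hξ
    simpa [hc0 ξ] using hξ
  rw [← norm_eq_zero, ← Lp.norm_fourier_eq, hz, norm_zero]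

lemma exists_schwartz_conj_mul (u v : 𝓢(ℝ, ℂ)) : ∃ p : 𝓢(ℝ, ℂ), ∀ x, p x = conj (u x) * v x := by
  have hg : Function.HasTemperateGrowth fun x => schwartzConj u x :=
    (schwartzConj u).hasTemperateGrowth
  refine ⟨SchwartzMap.smulLeftCLM ℂ (fun x => schwartzConj u x) v, fun x => ?_⟩
  rw [SchwartzMap.smulLeftCLM_apply_apply hg]
  rfl

/-- `sandwich` is defined by choice, so uniqueness is what identifies it with an explicit operator.
The bounds on `a⁻¹` and `b⁻¹` ensure that every Schwartz `u`, `v` arises from some `f`, `g` in `L²`,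
and these are total on both sides. -/
theorem IsSandwich.unique {a b : ℝ → ℂ} (ha : Measurable a) (hb : Measurable b)
    (ha0 : ∀ ξ, a ξ ≠ 0) (hb0 : ∀ ξ, b ξ ≠ 0) {C : ℝ} (haC : ∀ ξ, ‖(a ξ)⁻¹‖ ≤ C * (1 + ξ ^ 2))
    (hbC : ∀ ξ, ‖(b ξ)⁻¹‖ ≤ C * (1 + ξ ^ 2)) {q : 𝓢'(ℝ, ℂ)} {T T' : L2 →L[ℂ] L2}
    (hT : IsSandwich a b q T) (hT' : IsSandwich a b q T') : T = T' := by
  rw [← sub_eq_zero]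
  have key : ∀ (v : 𝓢(ℝ, ℂ)) (g : L2), (∀ᵐ ξ : ℝ, (𝓕 g : L2) ξ = (b ξ)⁻¹ * 𝓕 v ξ) →
      (T - T') g = 0 := by
    intro v g hg
    refine eq_zero_of_orthogonal (c := fun ξ => (conj (a ξ))⁻¹) (C := C)
      (Complex.continuous_conj.measurable.comp ha).inv (fun ξ => ?_) (fun ξ => by simpa using ha0 ξ)
      fun u f hf => ?_
    · rw [← map_inv₀, RCLike.norm_conj]
      exact haC ξ
    · obtain ⟨p, hp⟩ := exists_schwartz_conj_mul u v
      have hu : ∀ᵐ ξ : ℝ, 𝓕 u ξ = conj (a ξ) * (𝓕 f : L2) ξ := by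
        filter_upwards [hf] with ξ hξ
        rw [hξ, mul_inv_cancel_left₀ (by simpa using ha0 ξ)]
      have hv : ∀ᵐ ξ : ℝ, 𝓕 v ξ = b ξ * (𝓕 g : L2) ξ := by
        filter_upwards [hg] with ξ hξ
        rw [hξ, mul_inv_cancel_left₀ (hb0 ξ)]
      rw [sub_apply, inner_sub_right, hT f g u v p hu hv hp, hT' f g u v p hu hv hp, sub_self]
  have hadj : ∀ x, (T - T').adjoint x = 0 := fun x =>
    eq_zero_of_orthogonal (c := fun ξ => (b ξ)⁻¹) hb.inv hbC (fun ξ => inv_ne_zero (hb0 ξ))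
      fun v g hg => by
        rw [ContinuousLinearMap.adjoint_inner_right, key v g hg, inner_zero_left]
  ext1 y
  refine ext_inner_left ℂ fun x => ?_
  rw [← ContinuousLinearMap.adjoint_inner_left, hadj, zero_apply]
  simp

lemma IsSandwich.sandwich_eq {a b : ℝ → ℂ} (ha : Measurable a) (hb : Measurable b)
    (ha0 : ∀ ξ, a ξ ≠ 0) (hb0 : ∀ ξ, b ξ ≠ 0) {C : ℝ} (haC : ∀ ξ, ‖(a ξ)⁻¹‖ ≤ C * (1 + ξ ^ 2))
    (hbC : ∀ ξ, ‖(b ξ)⁻¹‖ ≤ C * (1 + ξ ^ 2)) {q : 𝓢'(ℝ, ℂ)} {T : L2 →L[ℂ] L2}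
    (hT : IsSandwich a b q T) : sandwich a b q = T := by
  have hex : ∃ T, IsSandwich a b q T := ⟨T, hT⟩
  rw [sandwich, dif_pos hex]
  exact IsSandwich.unique ha hb ha0 hb0 haC hbC hex.choose_spec hT

/-! ### The Fourier transform of an element of `H^s` -/

/-- The symbol `4κ² + (2πζ)²` of `4κ² - ∂²`. -/
def wt (κ ζ : ℝ) : ℝ := 4 * κ ^ 2 + (2 * π * ζ) ^ 2

lemma wt_pos {κ : ℝ} (hκ : κ ≠ 0) (ζ : ℝ) : 0 < wt κ ζ := by
  unfold wt; positivity

lemma continuous_wt (κ : ℝ) : Continuous (wt κ) := by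
  unfold wt; fun_prop

lemma one_add_sq_le_wt {κ : ℝ} (hκ : 1 ≤ κ) (ζ : ℝ) : 1 + ζ ^ 2 ≤ wt κ ζ := by
  unfold wt
  have : 1 ≤ (2 * π) ^ 2 := by nlinarith [Real.pi_gt_three]
  nlinarith [mul_le_mul_of_nonneg_right this (sq_nonneg ζ)]

lemma hasTemperateGrowth_wt_rpow {κ : ℝ} (hκ : 0 < κ) (r : ℝ) :
    Function.HasTemperateGrowth fun ξ : ℝ => (((4 * κ ^ 2 + (2 * π * ξ) ^ 2) ^ r : ℝ) : ℂ) := by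
  have h1 := (Function.hasTemperateGrowth_one_add_norm_sq_rpow ℝ r).comp
    (((π / κ) • ContinuousLinearMap.id ℝ ℝ).hasTemperateGrowth)
  have h2 : Function.HasTemperateGrowth fun ξ : ℝ =>
      ((((4 * κ ^ 2) ^ r * (1 + ‖π / κ * ξ‖ ^ 2) ^ r : ℝ)) : ℂ) := by
    have h3 : Function.HasTemperateGrowth fun ξ : ℝ => (1 + ‖π / κ * ξ‖ ^ 2) ^ r := h1
    fun_prop
  convert! h2 using 3 with ξ
  rw [← Real.mul_rpow (by positivity) (by positivity), Real.norm_eq_abs, sq_abs]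
  congr 1
  field_simp
  ring

/-- The function `Q` is the Fourier transform of `q ∈ H^s`. -/
structure IsSymbol (s : ℝ) (q : 𝓢'(ℝ, ℂ)) (Q : ℝ → ℂ) : Prop where
  measurable : Measurable Q
  integrable_sq : ∀ κ : ℝ, 1 ≤ κ → Integrable fun ζ => ‖Q ζ‖ ^ 2 * wt κ ζ ^ s
  norm_sq : ∀ κ : ℝ, 1 ≤ κ → sobolevNorm s κ q ^ 2 = ∫ ζ, ‖Q ζ‖ ^ 2 * wt κ ζ ^ s
  integrable_weighted : Integrable fun ζ : ℝ => (((1 + ζ ^ 2)⁻¹ : ℝ) : ℂ) * Q ζ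
  apply_eq : ∀ p : 𝓢(ℝ, ℂ), q p = ∫ ζ, 𝓕⁻ p ζ * Q ζ

lemma sobolevNorm_eq_of_fourier {s κ : ℝ} (hκ : 0 < κ) {q : 𝓢'(ℝ, ℂ)} {Q : ℝ → ℂ}
    (hq : ∀ p : 𝓢(ℝ, ℂ), q p = ∫ ζ, 𝓕⁻ p ζ * Q ζ)
    (hm : MemLp (fun ζ => ((wt κ ζ ^ (s / 2) : ℝ) : ℂ) * Q ζ) 2 volume) :
    sobolevNorm s κ q = ‖hm.toLp‖ := by
  have heq : sobolevMultiplier s κ q = ((𝓕⁻ hm.toLp : L2) : 𝓢'(ℝ, ℂ)) := by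
    rw [← Lp.fourierInv_toTemperedDistribution_eq]
    ext u
    rw [sobolevMultiplier, TemperedDistribution.fourierMultiplierCLM_apply_apply, hq,
      TemperedDistribution.fourierInv_apply, Lp.toTemperedDistribution_apply,
      fourierInv_fourier_eq]
    refine integral_congr_ae ?_
    filter_upwards [hm.coeFn_toLp] with ζ hζ
    rw [hζ, SchwartzMap.smulLeftCLM_apply_apply (hasTemperateGrowth_wt_rpow hκ _), smul_eq_mul,
      smul_eq_mul, wt]
    ring
  have hex : ∃ f : L2, sobolevMultiplier s κ q = (f : 𝓢'(ℝ, ℂ)) := ⟨_, heq⟩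
  rw [sobolevNorm, dif_pos hex]
  -- The chosen `L²` representative is pinned down by injectivity of `L² → 𝓢'`.
  have hinj : hex.choose = 𝓕⁻ hm.toLp := by
    have hker := Lp.ker_toTemperedDistributionCLM_eq_bot (F := ℂ) (μ := (volume : Measure ℝ))
      (p := 2)
    refine LinearMap.ker_eq_bot.mp hker ?_
    change (hex.choose : 𝓢'(ℝ, ℂ)) = ((𝓕⁻ hm.toLp : L2) : 𝓢'(ℝ, ℂ))
    rw [← hex.choose_spec, heq]
  rw [hinj, ← Lp.norm_fourier_eq, fourier_fourierInv_eq]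

lemma norm_sq_toLp {φ : ℝ → ℂ} (hm : MemLp φ 2 volume) : ‖hm.toLp‖ ^ 2 = ∫ x, ‖φ x‖ ^ 2 := by
  rw [norm_sq_L2]
  refine integral_congr_ae ?_
  filter_upwards [hm.coeFn_toLp] with x hx
  rw [hx]

theorem exists_isSymbol {s : ℝ} (hs : -(1 / 2) < s) (hs' : s < 0) {q : 𝓢'(ℝ, ℂ)}
    (hq : TemperedDistribution.MemSobolev s 2 q) : ∃ Q, IsSymbol s q Q := by
  obtain ⟨F, hF⟩ := TemperedDistribution.memSobolev_iff_exists_smulLeftCLM_fourier.mp hq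
  set m : ℝ → ℂ := fun x => (((1 + ‖x‖ ^ 2) ^ (s / 2) : ℝ) : ℂ) with hmdef
  set m' : ℝ → ℂ := fun x => (((1 + ‖x‖ ^ 2) ^ (-s / 2) : ℝ) : ℂ) with hmdef'
  have hmt : Function.HasTemperateGrowth m := by fun_prop
  have hmt' : Function.HasTemperateGrowth m' := by fun_prop
  have hmm : ∀ x, m x * m' x = 1 := by
    intro x
    rw [hmdef, hmdef', ← Complex.ofReal_mul, ← Real.rpow_add (by positivity)]
    simp [neg_div]
  have hFm : Measurable (F : ℝ → ℂ) := (Lp.stronglyMeasurable F).measurable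
  have hm'meas : Measurable m' := by
    have : Measurable fun x : ℝ => (1 + ‖x‖ ^ 2) ^ (-s / 2) := by fun_prop
    exact Complex.measurable_ofReal.comp this
  have happ : ∀ p : 𝓢(ℝ, ℂ), q p = ∫ ζ, 𝓕⁻ p ζ * (m' ζ * F ζ) := by
    intro p
    -- Testing against `m' · 𝓕⁻ p` removes the weight `m`, because `m m' = 1`.
    have h1 := congrArg (fun w : 𝓢'(ℝ, ℂ) => w (SchwartzMap.smulLeftCLM ℂ m' (𝓕⁻ p))) hF
    simp only [TemperedDistribution.smulLeftCLM_apply_apply, TemperedDistribution.fourier_apply]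
      at h1
    rw [SchwartzMap.smulLeftCLM_smulLeftCLM_apply hmt hmt'] at h1
    have h2 : SchwartzMap.smulLeftCLM ℂ (m * m') (𝓕⁻ p) = 𝓕⁻ p := by
      ext x
      rw [SchwartzMap.smulLeftCLM_apply_apply (hmt.mul hmt')]
      simp [hmm]
    rw [h2, fourier_fourierInv_eq] at h1
    rw [h1, Lp.toTemperedDistribution_apply]
    congr 1
    funext ζ
    rw [SchwartzMap.smulLeftCLM_apply_apply hmt', smul_eq_mul, smul_eq_mul]
    ring
  have hmem : ∀ κ : ℝ, 1 ≤ κ →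
      MemLp (fun ζ => ((wt κ ζ ^ (s / 2) : ℝ) : ℂ) * (m' ζ * F ζ)) 2 volume := by
    intro κ hκ
    refine (Lp.memLp F).mono ?_ (ae_of_all _ fun ζ => ?_)
    · have : Measurable fun ζ => wt κ ζ ^ (s / 2) := (continuous_wt κ).measurable.pow_const _
      exact ((Complex.measurable_ofReal.comp this).mul (hm'meas.mul hFm)).aestronglyMeasurable
    · rw [← mul_assoc, norm_mul, ← Complex.ofReal_mul, Complex.norm_real]
      refine mul_le_of_le_one_left (norm_nonneg _) ?_
      have hw := wt_pos (by linarith : κ ≠ 0) ζ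
      rw [Real.norm_of_nonneg (by positivity)]
      calc wt κ ζ ^ (s / 2) * (1 + ‖ζ‖ ^ 2) ^ (-s / 2)
          ≤ (1 + ‖ζ‖ ^ 2) ^ (s / 2) * (1 + ‖ζ‖ ^ 2) ^ (-s / 2) := by
            gcongr ?_ * _
            refine Real.rpow_le_rpow_of_nonpos (by positivity) ?_ (by linarith)
            rw [Real.norm_eq_abs, sq_abs]
            exact one_add_sq_le_wt hκ ζ
        _ = 1 := by
          rw [← Real.rpow_add (by positivity)]
          simp [neg_div]
  have hsq : ∀ κ : ℝ, 1 ≤ κ → ∀ ζ, ‖((wt κ ζ ^ (s / 2) : ℝ) : ℂ) * (m' ζ * F ζ)‖ ^ 2 =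
      ‖m' ζ * F ζ‖ ^ 2 * wt κ ζ ^ s := by
    intro κ hκ ζ
    have hw := wt_pos (by linarith : κ ≠ 0) ζ
    rw [norm_mul, Complex.norm_real, mul_pow, Real.norm_of_nonneg (by positivity),
      ← Real.rpow_natCast, ← Real.rpow_mul hw.le, mul_comm]
    norm_num
  refine ⟨fun ζ => m' ζ * F ζ, hm'meas.mul hFm, fun κ hκ => ?_, fun κ hκ => ?_, ?_, happ⟩
  · have h := (memLp_two_iff_integrable_sq_norm (hmem κ hκ).1).mp (hmem κ hκ)
    exact h.congr (ae_of_all _ (hsq κ hκ))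
  · rw [sobolevNorm_eq_of_fourier (by linarith) happ (hmem κ hκ), norm_sq_toLp]
    simp_rw [hsq κ hκ]
  -- Cauchy-Schwarz against `F ∈ L²`: the remaining weight squares to `(1 + ζ²)^(-2-s)`, integrable
  -- since `4 + 2s > 1`.
  · have h1 : MemLp (fun ζ : ℝ => (((1 + ‖ζ‖ ^ 2) ^ (-1 + -s / 2) : ℝ) : ℂ)) 2 volume := by
      have hmeas : Measurable fun ζ : ℝ => (1 + ‖ζ‖ ^ 2) ^ (-1 + -s / 2) := by fun_prop
      have hmeas' : Measurable fun ζ : ℝ => (((1 + ‖ζ‖ ^ 2) ^ (-1 + -s / 2) : ℝ) : ℂ) :=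
        Complex.measurable_ofReal.comp hmeas
      rw [memLp_two_iff_integrable_sq_norm hmeas'.aestronglyMeasurable]
      have h2 : Integrable fun ζ : ℝ => (1 + ‖ζ‖ ^ 2) ^ (-(4 + 2 * s) / 2) :=
        integrable_rpow_neg_one_add_norm_sq (by simp; linarith)
      refine h2.congr (ae_of_all _ fun ζ => ?_)
      have hB : 0 < 1 + ‖ζ‖ ^ 2 := by positivity
      simp only
      generalize 1 + ‖ζ‖ ^ 2 = B at hB ⊢
      rw [Complex.norm_real, Real.norm_of_nonneg (by positivity), ← Real.rpow_natCast,
        ← Real.rpow_mul hB.le]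
      congr 1
      push_cast
      ring
    refine (h1.integrable_mul (Lp.memLp F)).congr (ae_of_all _ fun ζ => ?_)
    simp only [Pi.mul_apply]
    rw [← mul_assoc, ← Complex.ofReal_mul, Real.rpow_add (by positivity), Real.rpow_neg_one,
      Real.norm_eq_abs, sq_abs]

/-! ### The symbols -/

lemma measurable_symMinus_uncurry : Measurable fun p : ℝ × ℝ => symMinus p.1 p.2 := by
  unfold symMinus
  refine Measurable.pow_const ?_ _
  fun_prop

lemma measurable_symPlus_uncurry : Measurable fun p : ℝ × ℝ => symPlus p.1 p.2 := by
  unfold symPlus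
  refine Measurable.pow_const ?_ _
  fun_prop

lemma measurable_symMinus (κ : ℝ) : Measurable (symMinus κ) :=
  measurable_symMinus_uncurry.comp measurable_prodMk_left

lemma measurable_symPlus (κ : ℝ) : Measurable (symPlus κ) :=
  measurable_symPlus_uncurry.comp measurable_prodMk_left

lemma norm_sq_cpow_neg_half {x y : ℝ} (hx : x ≠ 0) :
    ‖((x : ℂ) + y * Complex.I) ^ (-(1 / 2) : ℂ)‖ ^ 2 = (x ^ 2 + y ^ 2) ^ (-(1 / 2) : ℝ) := by
  have hz : (x : ℂ) + y * Complex.I ≠ 0 := fun h => hx (by simpa using congrArg Complex.re h)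
  have h0 : 0 < x ^ 2 + y ^ 2 := by positivity
  rw [Complex.norm_cpow_of_ne_zero hz]
  have him : (-(1 / 2) : ℂ).im = 0 := by norm_num
  have hre : (-(1 / 2) : ℂ).re = -(1 / 2) := by norm_num
  rw [him, hre, mul_zero, Real.exp_zero, div_one, Complex.norm_add_mul_I, Real.sqrt_eq_rpow,
    ← Real.rpow_mul h0.le, ← Real.rpow_natCast, ← Real.rpow_mul h0.le]
  norm_num

lemma cpow_neg_half_sq {z : ℂ} (hz : z ≠ 0) : (z ^ (-(1 / 2) : ℂ)) ^ 2 = z⁻¹ := by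
  rw [sq, ← Complex.cpow_add _ _ hz, ← Complex.cpow_neg_one]
  norm_num

lemma symMinus_eq (κ ξ : ℝ) :
    symMinus κ ξ = ((κ : ℂ) + (-(2 * π * ξ) : ℝ) * Complex.I) ^ (-(1 / 2) : ℂ) := by
  unfold symMinus
  congr 1
  push_cast
  ring

lemma symPlus_eq (κ ξ : ℝ) :
    symPlus κ ξ = ((κ : ℂ) + ((2 * π * ξ) : ℝ) * Complex.I) ^ (-(1 / 2) : ℂ) := by
  unfold symPlus
  push_cast
  rfl

lemma norm_sq_symMinus {κ : ℝ} (hκ : κ ≠ 0) (ξ : ℝ) :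
    ‖symMinus κ ξ‖ ^ 2 = (κ ^ 2 + (2 * π * ξ) ^ 2) ^ (-(1 / 2) : ℝ) := by
  rw [symMinus_eq, norm_sq_cpow_neg_half hκ, neg_sq]

lemma norm_sq_symPlus {κ : ℝ} (hκ : κ ≠ 0) (ξ : ℝ) :
    ‖symPlus κ ξ‖ ^ 2 = (κ ^ 2 + (2 * π * ξ) ^ 2) ^ (-(1 / 2) : ℝ) := by
  rw [symPlus_eq, norm_sq_cpow_neg_half hκ]

lemma symMinus_sq {κ : ℝ} (hκ : κ ≠ 0) (ξ : ℝ) :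
    symMinus κ ξ ^ 2 = ((κ : ℂ) - 2 * π * ξ * Complex.I)⁻¹ :=
  cpow_neg_half_sq fun h => hκ (by simpa using congrArg Complex.re h)

lemma symPlus_sq {κ : ℝ} (hκ : κ ≠ 0) (ξ : ℝ) :
    symPlus κ ξ ^ 2 = ((κ : ℂ) + 2 * π * ξ * Complex.I)⁻¹ :=
  cpow_neg_half_sq fun h => hκ (by simpa using congrArg Complex.re h)

lemma ne_zero_of_norm_sq_eq {κ ξ : ℝ} (hκ : κ ≠ 0) {a : ℂ}
    (ha : ‖a‖ ^ 2 = (κ ^ 2 + (2 * π * ξ) ^ 2) ^ (-(1 / 2) : ℝ)) : a ≠ 0 := by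
  rintro rfl
  have : 0 < (κ ^ 2 + (2 * π * ξ) ^ 2) ^ (-(1 / 2) : ℝ) := by positivity
  simp at ha
  exact absurd ha (by simpa using this.ne)

lemma norm_inv_le_of_norm_sq_eq {κ ξ : ℝ} (hκ : κ ≠ 0) {a : ℂ}
    (ha : ‖a‖ ^ 2 = (κ ^ 2 + (2 * π * ξ) ^ 2) ^ (-(1 / 2) : ℝ)) :
    ‖a⁻¹‖ ≤ (1 + κ ^ 2 + (2 * π) ^ 2) * (1 + ξ ^ 2) := by
  have h0 : 0 < κ ^ 2 + (2 * π * ξ) ^ 2 := by positivity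
  have h1 : ‖a⁻¹‖ ^ 2 = (κ ^ 2 + (2 * π * ξ) ^ 2) ^ (1 / 2 : ℝ) := by
    rw [norm_inv, inv_pow, ha, ← Real.rpow_neg h0.le, neg_neg]
  have h2 : (κ ^ 2 + (2 * π * ξ) ^ 2) ^ (1 / 2 : ℝ) ≤ 1 + κ ^ 2 + (2 * π * ξ) ^ 2 := by
    calc (κ ^ 2 + (2 * π * ξ) ^ 2) ^ (1 / 2 : ℝ)
        ≤ (1 + κ ^ 2 + (2 * π * ξ) ^ 2) ^ (1 / 2 : ℝ) := by gcongr; linarith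
      _ ≤ (1 + κ ^ 2 + (2 * π * ξ) ^ 2) ^ (1 : ℝ) :=
        Real.rpow_le_rpow_of_exponent_le (by nlinarith [sq_nonneg κ, sq_nonneg (2 * π * ξ)])
          (by norm_num)
      _ = _ := Real.rpow_one _
  have h3 : 1 + κ ^ 2 + (2 * π * ξ) ^ 2 ≤ (1 + κ ^ 2 + (2 * π) ^ 2) * (1 + ξ ^ 2) := by
    nlinarith [sq_nonneg κ, sq_nonneg (2 * π), sq_nonneg ξ, mul_nonneg (sq_nonneg κ) (sq_nonneg ξ)]
  have h4 : 1 ≤ 1 + κ ^ 2 + (2 * π * ξ) ^ 2 := by nlinarith [sq_nonneg κ, sq_nonneg (2 * π * ξ)]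
  have h5 : ‖a⁻¹‖ ≤ 1 + κ ^ 2 + (2 * π * ξ) ^ 2 := by
    refine le_of_sq_le_sq ?_ (by linarith)
    rw [h1]
    nlinarith
  linarith

/-! ### The weight of the Hilbert-Schmidt norm -/

/-- Decouples the two factors so that each can be integrated alone. If `V ≤ U`, the nonnegative
power `1/2 + s` of `V` is moved to `U`, leaving `U^s V^(-1-s)`; then `w ≤ 8U` and `s < 0` turn `U^s`
into `w^s`. -/
lemma rpow_neg_half_mul_le {s U V w : ℝ} (hs : -(1 / 2) < s) (hs' : s < 0) (hU : 0 < U) (hV : 0 < V)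
    (hw : 0 < w) (hUw : w ≤ 4 * (U + V)) :
    U ^ (-(1 / 2) : ℝ) * V ^ (-(1 / 2) : ℝ)
      ≤ 8 ^ (-s) * w ^ s * (U ^ (-1 - s) + V ^ (-1 - s)) := by
  wlog hVU : V ≤ U generalizing U V
  · have := this hV hU (by linarith) (by linarith)
    rw [mul_comm, add_comm (U ^ _)]
    exact this
  have h1 : 1 ≤ 8 ^ (-s) * w ^ s * U ^ (-s) := by
    have h2 : (8 * U) ^ s ≤ w ^ s := Real.rpow_le_rpow_of_nonpos hw (by linarith) hs'.le
    have h3 : (8 : ℝ) ^ (-s) * U ^ (-s) * (8 * U) ^ s = 1 := by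
      rw [← Real.mul_rpow (by norm_num) hU.le, ← Real.rpow_add (by positivity)]
      simp
    calc 1 = (8 : ℝ) ^ (-s) * U ^ (-s) * (8 * U) ^ s := h3.symm
      _ ≤ 8 ^ (-s) * U ^ (-s) * w ^ s := by gcongr
      _ = _ := by ring
  have h4 : U ^ (-(1 / 2) : ℝ) * V ^ (-(1 / 2) : ℝ) ≤ U ^ s * V ^ (-1 - s) := by
    calc U ^ (-(1 / 2) : ℝ) * V ^ (-(1 / 2) : ℝ)
        = U ^ (-(1 / 2) : ℝ) * V ^ (1 / 2 + s) * V ^ (-1 - s) := by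
          rw [mul_assoc, ← Real.rpow_add hV]
          congr 2
          ring
      _ ≤ U ^ (-(1 / 2) : ℝ) * U ^ (1 / 2 + s) * V ^ (-1 - s) := by
          gcongr ?_ * ?_ * _
          exact Real.rpow_le_rpow hV.le hVU (by linarith)
      _ = _ := by
          rw [← Real.rpow_add hU]
          congr 2
          ring
  calc _ ≤ U ^ s * V ^ (-1 - s) := h4
    _ ≤ U ^ s * V ^ (-1 - s) * (8 ^ (-s) * w ^ s * U ^ (-s)) :=
        le_mul_of_one_le_right (by positivity) h1
    _ = 8 ^ (-s) * w ^ s * (V ^ (-1 - s)) * (U ^ s * U ^ (-s)) := by ring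
    _ = 8 ^ (-s) * w ^ s * (V ^ (-1 - s)) := by
        rw [← Real.rpow_add hU]
        simp
    _ ≤ _ := by
        gcongr
        have : 0 < U ^ (-1 - s) := by positivity
        linarith

lemma integrable_symbol_rpow {s κ : ℝ} (hs' : s < -(1 / 2)) (hκ : κ ≠ 0) :
    Integrable (fun η : ℝ => (κ ^ 2 + (2 * π * η) ^ 2) ^ s) ∧
      ∫ η : ℝ, (κ ^ 2 + (2 * π * η) ^ 2) ^ s
        = |κ| ^ (2 * s + 1) * ((2 * π)⁻¹ * ∫ x : ℝ, (1 + x ^ 2) ^ s) := by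
  have hκ' : 0 < |κ| := abs_pos.mpr hκ
  have hint : Integrable fun x : ℝ => (1 + x ^ 2) ^ s := by
    have h : Integrable fun x : ℝ => (1 + ‖x‖ ^ 2) ^ (-(-2 * s) / 2) :=
      integrable_rpow_neg_one_add_norm_sq (by simp; linarith)
    refine h.congr (ae_of_all _ fun x => ?_)
    simp only [Real.norm_eq_abs, sq_abs]
    congr 1
    ring
  have heq : ∀ η : ℝ, (κ ^ 2 + (2 * π * η) ^ 2) ^ s
      = |κ| ^ (2 * s) * (1 + (2 * π / |κ| * η) ^ 2) ^ s := by
    intro η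
    rw [Real.rpow_mul hκ'.le, ← Real.mul_rpow (by positivity) (by positivity)]
    congr 1
    rw [mul_comm (2 * π / |κ|), mul_div_assoc', div_pow, mul_add, Real.rpow_two, sq_abs]
    field_simp
  have hc : 2 * π / |κ| ≠ 0 := by positivity
  simp_rw [heq]
  refine ⟨(hint.comp_mul_left' hc).const_mul _, ?_⟩
  rw [integral_const_mul, Measure.integral_comp_mul_left (fun x : ℝ => (1 + x ^ 2) ^ s),
    Real.rpow_add hκ', Real.rpow_one, smul_eq_mul,
    abs_of_pos (show 0 < (2 * π / |κ|)⁻¹ by positivity), inv_div]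
  ring

/-- After decoupling, both summands have the same integral over `η` by translation; it converges
because `-1 - s < -1/2`, and scaling produces the power of `|κ|`. -/
theorem exists_weight_bound {s : ℝ} (hs : -(1 / 2) < s) (hs' : s < 0) :
    ∃ C : ℝ, 0 < C ∧ ∀ κ : ℝ, κ ≠ 0 → ∀ ζ : ℝ,
      ∫⁻ η, ENNReal.ofReal ((κ ^ 2 + (2 * π * (ζ + η)) ^ 2) ^ (-(1 / 2) : ℝ)
          * (κ ^ 2 + (2 * π * η) ^ 2) ^ (-(1 / 2) : ℝ))
        ≤ ENNReal.ofReal (C * |κ| ^ (-1 - 2 * s) * wt κ ζ ^ s) := by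
  set c := ∫ x : ℝ, (1 + x ^ 2) ^ (-1 - s) with hc
  have hc0 : 0 ≤ c := integral_nonneg fun x => by positivity
  -- The `+ 1` makes the constant positive from `0 ≤ c` alone.
  refine ⟨8 ^ (-s) * 2 * ((2 * π)⁻¹ * (c + 1)), by positivity, fun κ hκ ζ => ?_⟩
  obtain ⟨h1, h2⟩ := integrable_symbol_rpow (s := -1 - s) (by linarith) hκ
  have h1' := h1.comp_add_left ζ
  have hκ' : 0 < |κ| := abs_pos.mpr hκ
  have hw := wt_pos hκ ζ
  calc _ ≤ ∫⁻ η, ENNReal.ofReal (8 ^ (-s) * wt κ ζ ^ s *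
        ((κ ^ 2 + (2 * π * (ζ + η)) ^ 2) ^ (-1 - s) + (κ ^ 2 + (2 * π * η) ^ 2) ^ (-1 - s))) := by
        refine lintegral_mono fun η => ENNReal.ofReal_le_ofReal ?_
        refine rpow_neg_half_mul_le hs hs' (by positivity) (by positivity) hw ?_
        unfold wt
        nlinarith [sq_nonneg (2 * π * (ζ + η) + 2 * π * η), sq_nonneg κ,
          sq_nonneg (2 * π * (ζ + η)), sq_nonneg (2 * π * η)]
    _ = ENNReal.ofReal (∫ η, 8 ^ (-s) * wt κ ζ ^ s *
        ((κ ^ 2 + (2 * π * (ζ + η)) ^ 2) ^ (-1 - s) + (κ ^ 2 + (2 * π * η) ^ 2) ^ (-1 - s))) :=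
        (ofReal_integral_eq_lintegral_ofReal ((h1'.add h1).const_mul _)
          (ae_of_all _ fun η => by simp only [Pi.zero_apply, Pi.add_apply]; positivity)).symm
    _ ≤ _ := by
        refine ENNReal.ofReal_le_ofReal ?_
        have h3 := integral_add_left_eq_self (μ := volume)
          (fun η : ℝ => (κ ^ 2 + (2 * π * η) ^ 2) ^ (-1 - s)) ζ
        rw [integral_const_mul, integral_add h1' h1, h3, h2,
          show 2 * (-1 - s) + 1 = -1 - 2 * s by ring]
        calc _ = 8 ^ (-s) * 2 * ((2 * π)⁻¹ * c) * |κ| ^ (-1 - 2 * s) * wt κ ζ ^ s := by ring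
          _ ≤ _ := by
            gcongr
            linarith

/-! ### The leading term -/

/-- In the variable `t = 1/η` the ratio extends continuously to `t = 0`, with value `1`. -/
lemma tendsto_log_quadratic_ratio {κ : ℝ} (ζ : ℝ) {l : Filter ℝ}
    (hl : Filter.Tendsto (fun η : ℝ => η⁻¹) l (nhds 0)) (hl0 : ∀ᶠ η in l, η ≠ 0) :
    Filter.Tendsto (fun η => Real.log ((κ ^ 2 + (2 * π * (ζ + η)) ^ 2) / (κ ^ 2 + (2 * π * η) ^ 2)))
      l (nhds 0) := by
  have hcont : ContinuousAt (fun t : ℝ => Real.log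
      ((κ ^ 2 * t ^ 2 + (2 * π * (ζ * t + 1)) ^ 2) / (κ ^ 2 * t ^ 2 + (2 * π) ^ 2))) 0 := by
    have hpi := Real.pi_pos
    refine ContinuousAt.log (ContinuousAt.div₀ (by fun_prop) (by fun_prop) (by positivity)) ?_
    simp [hpi.ne']
  have h := hcont.tendsto.comp hl
  have h0 : Real.log ((κ ^ 2 * (0 : ℝ) ^ 2 + (2 * π * (ζ * 0 + 1)) ^ 2) /
      (κ ^ 2 * 0 ^ 2 + (2 * π) ^ 2)) = 0 := by
    simp
  rw [h0] at h
  refine h.congr' ?_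
  filter_upwards [hl0] with η hη
  simp only [Function.comp_apply]
  congr 1
  field_simp

lemma integrable_symbol_mul {κ : ℝ} (hκ : 0 < κ) (ζ : ℝ) :
    Integrable fun η : ℝ => ((κ : ℂ) - 2 * π * (ζ + η) * Complex.I)⁻¹ *
      ((κ : ℂ) + 2 * π * η * Complex.I)⁻¹ := by
  -- Any admissible exponent would do; only finiteness of the integral is needed.
  obtain ⟨C, hC, hb⟩ := exists_weight_bound (s := -(1 / 4)) (by norm_num) (by norm_num)
  have hm : Measurable fun η : ℝ => ((κ : ℂ) - 2 * π * (ζ + η) * Complex.I)⁻¹ *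
      ((κ : ℂ) + 2 * π * η * Complex.I)⁻¹ := by fun_prop
  refine ⟨hm.aestronglyMeasurable, ?_⟩
  refine lt_of_le_of_lt (le_of_eq_of_le ?_ (hb κ hκ.ne' ζ)) ENNReal.ofReal_lt_top
  refine lintegral_congr fun η => ?_
  simp only
  have h1 := symMinus_sq hκ.ne' (ζ + η)
  have h2 := symPlus_sq hκ.ne' η
  push_cast at h1 h2
  rw [← h1, ← h2, ← ofReal_norm, norm_mul, norm_pow, norm_pow, norm_sq_symMinus hκ.ne',
    norm_sq_symPlus hκ.ne']

/-- The two denominators `z`, `w` have constant sum `D`, so `1/(zw) = (1/z + 1/w)/D`. The primitive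
is written with `arctan` and a real logarithm, avoiding branches: the logarithm of the ratio
vanishes at both ends and the arctangents increase by `2π` in total, cancelling the `(2π)⁻¹` of the
normalization. -/
theorem integral_symbol_mul {κ : ℝ} (hκ : 0 < κ) (ζ : ℝ) :
    ∫ η : ℝ, ((κ : ℂ) - 2 * π * (ζ + η) * Complex.I)⁻¹ * ((κ : ℂ) + 2 * π * η * Complex.I)⁻¹
      = (2 * κ - 2 * π * ζ * Complex.I)⁻¹ := by
  have hpi := Real.pi_pos
  let R : ℝ → ℝ := fun η => Real.arctan (2 * π * (ζ + η) / κ) + Real.arctan (2 * π * η / κ)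
  let S : ℝ → ℝ := fun η =>
    Real.log ((κ ^ 2 + (2 * π * (ζ + η)) ^ 2) / (κ ^ 2 + (2 * π * η) ^ 2))
  set D : ℂ := 2 * κ - 2 * π * ζ * Complex.I with hD
  have hD0 : D ≠ 0 := fun h => hκ.ne' (by simpa [hD] using congrArg Complex.re h)
  let F : ℝ → ℂ := fun η => D⁻¹ * (2 * (π : ℂ))⁻¹ * ((R η : ℂ) + (S η : ℂ) / 2 * Complex.I)
  have hR : ∀ η, HasDerivAt R (2 * π * κ / (κ ^ 2 + (2 * π * (ζ + η)) ^ 2)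
      + 2 * π * κ / (κ ^ 2 + (2 * π * η) ^ 2)) η := by
    intro η
    have h1 : HasDerivAt (fun η : ℝ => 2 * π * (ζ + η) / κ) (2 * π / κ) η := by
      simpa using (((hasDerivAt_id η).const_add ζ).const_mul (2 * π)).div_const κ
    have h2 : HasDerivAt (fun η : ℝ => 2 * π * η / κ) (2 * π / κ) η := by
      simpa using ((hasDerivAt_id η).const_mul (2 * π)).div_const κ
    convert! h1.arctan.add h2.arctan using 1
    congr 1 <;> field_simp
  have hS : ∀ η, HasDerivAt S (2 * (2 * π) * (2 * π * (ζ + η)) / (κ ^ 2 + (2 * π * (ζ + η)) ^ 2)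
      - 2 * (2 * π) * (2 * π * η) / (κ ^ 2 + (2 * π * η) ^ 2)) η := by
    intro η
    have h1 : HasDerivAt (fun η : ℝ => κ ^ 2 + (2 * π * (ζ + η)) ^ 2)
        (2 * (2 * π) * (2 * π * (ζ + η))) η := by
      convert! ((((hasDerivAt_id η).const_add ζ).const_mul (2 * π)).pow 2).const_add (κ ^ 2) using 1
      simp
      ring
    have h2 : HasDerivAt (fun η : ℝ => κ ^ 2 + (2 * π * η) ^ 2)
        (2 * (2 * π) * (2 * π * η)) η := by
      convert! (((hasDerivAt_id η).const_mul (2 * π)).pow 2).const_add (κ ^ 2) using 1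
      simp
      ring
    have hS' : S = fun η => Real.log (κ ^ 2 + (2 * π * (ζ + η)) ^ 2)
        - Real.log (κ ^ 2 + (2 * π * η) ^ 2) := by
      funext η
      exact Real.log_div (by positivity) (by positivity)
    rw [hS']
    exact (h1.log (by positivity)).sub (h2.log (by positivity))
  have hF : ∀ η : ℝ, HasDerivAt F (((κ : ℂ) - 2 * π * (ζ + η) * Complex.I)⁻¹ *
      ((κ : ℂ) + 2 * π * η * Complex.I)⁻¹) η := by
    intro η
    have h := ((hR η).ofReal_comp.add (((hS η).ofReal_comp.div_const 2).mul_const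
      Complex.I)).const_mul (D⁻¹ * (2 * π : ℂ)⁻¹)
    convert! h using 1
    set z : ℂ := (κ : ℂ) - 2 * π * (ζ + η) * Complex.I with hz
    set w : ℂ := (κ : ℂ) + 2 * π * η * Complex.I with hw
    have hz0 : z ≠ 0 := fun h => hκ.ne' (by simpa [hz] using congrArg Complex.re h)
    have hw0 : w ≠ 0 := fun h => hκ.ne' (by simpa [hw] using congrArg Complex.re h)
    set z' : ℂ := (κ : ℂ) + 2 * π * (ζ + η) * Complex.I with hz'
    set w' : ℂ := (κ : ℂ) - 2 * π * η * Complex.I with hw'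
    have hz0' : z' ≠ 0 := fun h => hκ.ne' (by simpa [hz'] using congrArg Complex.re h)
    have hw0' : w' ≠ 0 := fun h => hκ.ne' (by simpa [hw'] using congrArg Complex.re h)
    have e1 : ((κ ^ 2 + (2 * π * (ζ + η)) ^ 2 : ℝ) : ℂ) = z * z' := by
      rw [hz, hz']; push_cast; ring_nf; rw [Complex.I_sq]; ring
    have e2 : ((κ ^ 2 + (2 * π * η) ^ 2 : ℝ) : ℂ) = w * w' := by
      rw [hw, hw']; push_cast; ring_nf; rw [Complex.I_sq]; ring
    have e3 : z + w = D := by rw [hz, hw, hD]; ring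
    have hpi' : (2 * π : ℂ) ≠ 0 := by
      have : (π : ℂ) ≠ 0 := Complex.ofReal_ne_zero.mpr hpi.ne'
      simp [this]
    have e4 : (2 * π : ℂ)⁻¹ * (((2 * π * κ / (κ ^ 2 + (2 * π * (ζ + η)) ^ 2)
        + 2 * π * κ / (κ ^ 2 + (2 * π * η) ^ 2) : ℝ) : ℂ) +
        ((2 * (2 * π) * (2 * π * (ζ + η)) / (κ ^ 2 + (2 * π * (ζ + η)) ^ 2)
          - 2 * (2 * π) * (2 * π * η) / (κ ^ 2 + (2 * π * η) ^ 2) : ℝ) : ℂ) / 2 * Complex.I)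
        = z⁻¹ + w⁻¹ := by
      have e5 : z⁻¹ = z' / (z * z') := by field_simp
      have e6 : w⁻¹ = w' / (w * w') := by field_simp
      rw [Complex.ofReal_add, Complex.ofReal_sub, Complex.ofReal_div, Complex.ofReal_div,
        Complex.ofReal_div, Complex.ofReal_div, e1, e2, e5, e6, hz', hw']
      rw [← hz', ← hw']
      rw [inv_mul_eq_iff_eq_mul₀ hpi']
      push_cast
      simp only [div_eq_mul_inv]
      generalize (z * z')⁻¹ = A
      generalize (w * w')⁻¹ = B
      rw [hz', hw']
      ring
    rw [mul_assoc, e4, ← e3]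
    have : z + w ≠ 0 := e3 ▸ hD0
    field_simp
    ring
  have hinv0 : ∀ l : Filter ℝ, l = Filter.atTop ∨ l = Filter.atBot →
      Filter.Tendsto S l (nhds 0) := by
    rintro l (rfl | rfl)
    · exact tendsto_log_quadratic_ratio ζ tendsto_inv_atTop_zero (Filter.eventually_ne_atTop 0)
    · exact tendsto_log_quadratic_ratio ζ tendsto_inv_atBot_zero (Filter.eventually_ne_atBot 0)
  have hRtop : Filter.Tendsto R Filter.atTop (nhds (π / 2 + π / 2)) := by
    refine Filter.Tendsto.add ?_ ?_
    · refine (tendsto_nhds_of_tendsto_nhdsWithin Real.tendsto_arctan_atTop).comp ?_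
      exact ((Filter.tendsto_atTop_add_const_left _ ζ Filter.tendsto_id).const_mul_atTop (by positivity)).atTop_div_const hκ
    · refine (tendsto_nhds_of_tendsto_nhdsWithin Real.tendsto_arctan_atTop).comp ?_
      exact (Filter.tendsto_id.const_mul_atTop (by positivity)).atTop_div_const hκ
  have hRbot : Filter.Tendsto R Filter.atBot (nhds (-(π / 2) + -(π / 2))) := by
    refine Filter.Tendsto.add ?_ ?_
    · refine (tendsto_nhds_of_tendsto_nhdsWithin Real.tendsto_arctan_atBot).comp ?_
      exact ((Filter.tendsto_atBot_add_const_left _ ζ Filter.tendsto_id).const_mul_atBot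
        (by positivity)).atBot_div_const hκ
    · refine (tendsto_nhds_of_tendsto_nhdsWithin Real.tendsto_arctan_atBot).comp ?_
      exact (Filter.tendsto_id.const_mul_atBot (by positivity)).atBot_div_const hκ
  have hlim : ∀ (l : Filter ℝ) (r : ℝ), Filter.Tendsto R l (nhds r) → Filter.Tendsto S l (nhds 0) →
      Filter.Tendsto F l (nhds (D⁻¹ * (2 * (π : ℂ))⁻¹ * (r + ((0 : ℝ) : ℂ) / 2 * Complex.I))) := by
    intro l r h1 h2
    refine Filter.Tendsto.const_mul _ (Filter.Tendsto.add ?_ ?_)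
    · exact (Complex.continuous_ofReal.tendsto r).comp h1
    · exact (((Complex.continuous_ofReal.tendsto 0).comp h2).div_const 2).mul_const _
  rw [integral_of_hasDerivAt_of_tendsto hF (integrable_symbol_mul hκ ζ)
    (hlim _ _ hRbot (hinv0 _ (Or.inr rfl))) (hlim _ _ hRtop (hinv0 _ (Or.inl rfl)))]
  have hpi' : (π : ℂ) ≠ 0 := Complex.ofReal_ne_zero.mpr hpi.ne'
  push_cast
  field_simp
  ring

/-! ### The energy density -/

lemma wt_mono {κ ϰ : ℝ} (hκ : 0 ≤ κ) (h : κ ≤ ϰ) (ζ : ℝ) : wt κ ζ ≤ wt ϰ ζ := by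
  unfold wt
  gcongr

/-- The integrand changes behaviour at `M = √(wt κ ζ)`. Below `M` it is at most `2 M^(2s-1)` on an
interval shorter than `M`; above `M` it is comparable to `ϰ^(2s-1)`, whose integral is `M^(2s) /
(-2s)` because `s < 0`. Both are multiples of `M^(2s) = wt κ ζ ^ s`, and the lower bound needs only
the part above `M`. -/
theorem exists_energy_bounds {s : ℝ} (hs : -(1 / 2) < s) (hs' : s < 0) :
    ∃ c > 0, ∃ C > 0, ∀ κ : ℝ, 1 ≤ κ → ∀ ζ : ℝ,
      IntegrableOn (fun ϰ : ℝ => ϰ ^ (2 * s + 1) * (2 * ϰ / wt ϰ ζ) / ϰ) (Ioi κ) ∧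
      c * wt κ ζ ^ s ≤ ∫ ϰ in Ioi κ, ϰ ^ (2 * s + 1) * (2 * ϰ / wt ϰ ζ) / ϰ ∧
      ∫ ϰ in Ioi κ, ϰ ^ (2 * s + 1) * (2 * ϰ / wt ϰ ζ) / ϰ ≤ C * wt κ ζ ^ s := by
  have hs0 : 0 < -s := by linarith
  -- The `2/5` comes from `wt ϰ ζ ≤ 5ϰ²` beyond `M`; in the upper constant, the first `2` is the
  -- part below `M`, the rest the tail.
  refine ⟨2 / 5 * (2 * -s)⁻¹, by positivity, 2 + 2 * (2 * -s)⁻¹, by positivity, fun κ hκ ζ => ?_⟩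
  have hw := wt_pos (show κ ≠ 0 by linarith) ζ
  set M := Real.sqrt (wt κ ζ) with hMdef
  have hM2 : M ^ 2 = wt κ ζ := Real.sq_sqrt hw.le
  have hM0 : 0 < M := Real.sqrt_pos.mpr hw
  have hκM : κ ≤ M := by
    refine Real.le_sqrt_of_sq_le ?_
    unfold wt
    nlinarith [sq_nonneg (2 * π * ζ), sq_nonneg κ]
  have hMs : wt κ ζ ^ s = M ^ (2 * s) := by
    rw [← hM2, Real.rpow_mul hM0.le, Real.rpow_two]
  set j : ℝ → ℝ := fun ϰ => ϰ ^ (2 * s + 1) * (2 * ϰ / wt ϰ ζ) / ϰ with hj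
  have hj' : ∀ ϰ, 0 < ϰ → j ϰ = 2 * ϰ ^ (2 * s + 1) / wt ϰ ζ := by
    intro ϰ hϰ
    have := wt_pos hϰ.ne' ζ
    rw [hj]
    field_simp
  have hjm : Measurable j := by
    have : Measurable fun ϰ : ℝ => wt ϰ ζ := by unfold wt; fun_prop
    rw [hj]
    fun_prop
  have hj0 : ∀ ϰ, 0 < ϰ → 0 ≤ j ϰ := by
    intro ϰ hϰ
    have := wt_pos hϰ.ne' ζ
    rw [hj' ϰ hϰ]
    positivity
  have hlow : ∀ ϰ ∈ Ioc κ M, j ϰ ≤ 2 * M ^ (2 * s - 1) := by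
    rintro ϰ ⟨h1, h2⟩
    have hϰ : 0 < ϰ := by linarith
    rw [hj' ϰ hϰ, div_le_iff₀ (wt_pos hϰ.ne' ζ)]
    have h3 : ϰ ^ (2 * s + 1) ≤ M ^ (2 * s + 1) := Real.rpow_le_rpow hϰ.le h2 (by linarith)
    have h4 : M ^ 2 ≤ wt ϰ ζ := hM2 ▸ wt_mono (by linarith) h1.le ζ
    have h5 : M ^ (2 * s + 1) = M ^ (2 * s - 1) * M ^ 2 := by
      rw [← Real.rpow_two, ← Real.rpow_add hM0]
      ring_nf
    calc 2 * ϰ ^ (2 * s + 1) ≤ 2 * (M ^ (2 * s - 1) * M ^ 2) := by rw [← h5]; gcongr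
      _ ≤ 2 * (M ^ (2 * s - 1) * wt ϰ ζ) := by gcongr
      _ = _ := by ring
  have hsplit : ∀ ϰ : ℝ, 0 < ϰ → ϰ ^ (2 * s + 1) = ϰ ^ (2 * s - 1) * ϰ ^ 2 := by
    intro ϰ hϰ
    rw [← Real.rpow_two, ← Real.rpow_add hϰ]
    ring_nf
  have hhigh : ∀ ϰ ∈ Ioi M, j ϰ ≤ 2 * ϰ ^ (2 * s - 1) := by
    intro ϰ h1
    have hϰ : 0 < ϰ := hM0.trans h1
    rw [hj' ϰ hϰ, div_le_iff₀ (wt_pos hϰ.ne' ζ), hsplit ϰ hϰ, mul_assoc]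
    gcongr
    unfold wt
    nlinarith [sq_nonneg (2 * π * ζ), sq_nonneg ϰ]
  have hhigh' : ∀ ϰ ∈ Ioi M, 2 / 5 * ϰ ^ (2 * s - 1) ≤ j ϰ := by
    intro ϰ h1
    have hϰ : 0 < ϰ := hM0.trans h1
    rw [hj' ϰ hϰ, le_div_iff₀ (wt_pos hϰ.ne' ζ), hsplit ϰ hϰ]
    have h2 : (2 * π * ζ) ^ 2 ≤ ϰ ^ 2 := by
      have h3 : M ^ 2 ≤ ϰ ^ 2 := pow_le_pow_left₀ hM0.le (le_of_lt h1) 2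
      rw [hM2] at h3
      unfold wt at h3
      nlinarith [sq_nonneg κ]
    have h4 : wt ϰ ζ ≤ 5 * ϰ ^ 2 := by unfold wt; linarith
    calc 2 / 5 * ϰ ^ (2 * s - 1) * wt ϰ ζ ≤ 2 / 5 * ϰ ^ (2 * s - 1) * (5 * ϰ ^ 2) := by gcongr
      _ = _ := by ring
  have hint1 : IntegrableOn j (Ioc κ M) := by
    refine Measure.integrableOn_of_bounded (M := 2 * M ^ (2 * s - 1)) (by simp)
      hjm.aestronglyMeasurable ?_
    refine (ae_restrict_iff' measurableSet_Ioc).mpr (ae_of_all _ fun ϰ hϰ => ?_)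
    rw [Real.norm_of_nonneg (hj0 ϰ (by linarith [hϰ.1]))]
    exact hlow ϰ hϰ
  have hrpow : IntegrableOn (fun ϰ : ℝ => ϰ ^ (2 * s - 1)) (Ioi M) :=
    integrableOn_Ioi_rpow_of_lt (by linarith) hM0
  have hrval : ∫ ϰ in Ioi M, ϰ ^ (2 * s - 1) = (2 * -s)⁻¹ * M ^ (2 * s) := by
    rw [integral_Ioi_rpow_of_lt (by linarith) hM0, show 2 * s - 1 + 1 = 2 * s by ring]
    field_simp
  have hint2 : IntegrableOn j (Ioi M) := by
    refine Integrable.mono' (hrpow.const_mul 2) hjm.aestronglyMeasurable ?_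
    refine (ae_restrict_iff' measurableSet_Ioi).mpr (ae_of_all _ fun ϰ hϰ => ?_)
    rw [Real.norm_of_nonneg (hj0 ϰ (hM0.trans hϰ))]
    exact hhigh ϰ hϰ
  have hunion : Ioi κ = Ioc κ M ∪ Ioi M := (Ioc_union_Ioi_eq_Ioi hκM).symm
  have hval : ∫ ϰ in Ioi κ, j ϰ = (∫ ϰ in Ioc κ M, j ϰ) + ∫ ϰ in Ioi M, j ϰ := by
    rw [hunion]
    exact setIntegral_union (Set.disjoint_left.mpr fun x h1 h2 => not_lt.mpr h1.2 h2)
      measurableSet_Ioi hint1 hint2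
  have hI1 : 0 ≤ ∫ ϰ in Ioc κ M, j ϰ :=
    setIntegral_nonneg measurableSet_Ioc fun ϰ hϰ => hj0 ϰ (by linarith [hϰ.1])
  have hI1' : ∫ ϰ in Ioc κ M, j ϰ ≤ 2 * M ^ (2 * s) := by
    calc ∫ ϰ in Ioc κ M, j ϰ ≤ ∫ ϰ in Ioc κ M, 2 * M ^ (2 * s - 1) :=
          setIntegral_mono_on hint1 (integrableOn_const measure_Ioc_lt_top.ne) measurableSet_Ioc hlow
      _ = (M - κ) * (2 * M ^ (2 * s - 1)) := by
          simp [hκM]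
      _ ≤ M * (2 * M ^ (2 * s - 1)) := by gcongr; linarith
      _ = 2 * M ^ (2 * s) := by
          rw [Real.rpow_sub_one hM0.ne']
          field_simp
  have hI2 : ∫ ϰ in Ioi M, j ϰ ≤ 2 * ((2 * -s)⁻¹ * M ^ (2 * s)) := by
    rw [← hrval, ← integral_const_mul]
    exact setIntegral_mono_on hint2 (hrpow.const_mul 2) measurableSet_Ioi hhigh
  have hI2' : 2 / 5 * ((2 * -s)⁻¹ * M ^ (2 * s)) ≤ ∫ ϰ in Ioi M, j ϰ := by
    rw [← hrval, ← integral_const_mul]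
    exact setIntegral_mono_on (hrpow.const_mul _) hint2 measurableSet_Ioi hhigh'
  refine ⟨?_, ?_, ?_⟩
  · rw [hunion]
    exact hint1.union hint2
  · rw [hval, hMs]
    linarith
  · rw [hval, hMs]
    linarith

/-! ### Hilbert-Schmidt bounds for the sandwich kernels -/

lemma measurable_sandwichKernel {a b Q : ℝ → ℂ} (ha : Measurable a) (hb : Measurable b)
    (hQ : Measurable Q) : Measurable (Function.uncurry (sandwichKernel a b Q)) := by
  have h : Measurable fun p : ℝ × ℝ => a p.2 * Q (p.2 - p.1) * b p.1 := by fun_prop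
  exact h

/-- The modulus squared of `(κ ∓ ∂)^(-1/2)`. -/
def IsHalfSymbol (κ : ℝ) (a : ℝ → ℂ) : Prop :=
  Measurable a ∧ ∀ ξ, ‖a ξ‖ ^ 2 = (κ ^ 2 + (2 * π * ξ) ^ 2) ^ (-(1 / 2) : ℝ)

lemma isHalfSymbol_symMinus {κ : ℝ} (hκ : κ ≠ 0) : IsHalfSymbol κ (symMinus κ) :=
  ⟨measurable_symMinus κ, norm_sq_symMinus hκ⟩

lemma isHalfSymbol_symPlus {κ : ℝ} (hκ : κ ≠ 0) : IsHalfSymbol κ (symPlus κ) :=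
  ⟨measurable_symPlus κ, norm_sq_symPlus hκ⟩

lemma IsHalfSymbol.conj {κ : ℝ} {a : ℝ → ℂ} (ha : IsHalfSymbol κ a) :
    IsHalfSymbol κ fun ξ => conj (a ξ) :=
  ⟨Complex.continuous_conj.measurable.comp ha.1, fun ξ => by rw [RCLike.norm_conj, ha.2]⟩

/-- By Tonelli the `η`-integral is taken first; for fixed `ζ` it is the one in
`exists_weight_bound`, and the resulting `wt^s` rebuilds the Sobolev norm of `q`. -/
theorem exists_hilbertSchmidt_bound {s : ℝ} (hs : -(1 / 2) < s) (hs' : s < 0) :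
    ∃ C : ℝ, 0 < C ∧ ∀ (q : 𝓢'(ℝ, ℂ)) (Q : ℝ → ℂ), IsSymbol s q Q → ∀ κ : ℝ, 1 ≤ |κ| →
      ∀ a b : ℝ → ℂ, IsHalfSymbol κ a → IsHalfSymbol κ b →
        ∫⁻ η, ∫⁻ ζ, ‖a (ζ + η) * Q ζ * b η‖ₑ ^ 2
          ≤ ENNReal.ofReal (C * |κ| ^ (-1 - 2 * s) * sobolevNorm s |κ| q ^ 2) := by
  obtain ⟨C, hC, hb⟩ := exists_weight_bound hs hs'
  refine ⟨C, hC, fun q Q hQ κ hκ a b ha hb' => ?_⟩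
  have hκ0 : κ ≠ 0 := abs_pos.mp (by linarith)
  have ham := ha.1
  have hbm := hb'.1
  have hQm := hQ.measurable
  have hwt : ∀ ζ, wt |κ| ζ = wt κ ζ := fun ζ => by unfold wt; rw [sq_abs]
  have hsw := lintegral_lintegral_swap (μ := (volume : Measure ℝ)) (ν := (volume : Measure ℝ))
    (f := fun η ζ => ‖a (ζ + η) * Q ζ * b η‖ₑ ^ 2) (by
      refine Measurable.aemeasurable ?_
      have h : Measurable fun p : ℝ × ℝ => a (p.2 + p.1) * Q p.2 * b p.1 := by fun_prop
      exact h.enorm.pow_const 2)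
  rw [hsw, hQ.norm_sq _ hκ, ← integral_const_mul,
    ofReal_integral_eq_lintegral_ofReal ((hQ.integrable_sq _ hκ).const_mul _)
      (ae_of_all _ fun ζ => by have := wt_pos hκ0 ζ; simp only [Pi.zero_apply, hwt]; positivity)]
  refine lintegral_mono fun ζ => ?_
  have h1 : ∀ η, ‖a (ζ + η) * Q ζ * b η‖ₑ ^ 2 = ENNReal.ofReal (‖Q ζ‖ ^ 2) *
      ENNReal.ofReal ((κ ^ 2 + (2 * π * (ζ + η)) ^ 2) ^ (-(1 / 2) : ℝ)
          * (κ ^ 2 + (2 * π * η) ^ 2) ^ (-(1 / 2) : ℝ)) := by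
    intro η
    rw [← ofReal_norm, ← ENNReal.ofReal_pow (norm_nonneg _), ← ENNReal.ofReal_mul (by positivity),
      ← ha.2, ← hb'.2, norm_mul, norm_mul]
    congr 1
    ring
  simp_rw [h1]
  rw [lintegral_const_mul' _ _ ENNReal.ofReal_ne_top]
  refine (mul_le_mul_right (hb κ hκ0 ζ) _).trans (le_of_eq ?_)
  rw [← ENNReal.ofReal_mul (by positivity), hwt]
  congr 1
  ring

lemma lintegral_sandwichKernel_eq {a b Q : ℝ → ℂ} :
    ∫⁻ η, ∫⁻ ξ, ‖sandwichKernel a b Q η ξ‖ₑ ^ 2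
      = ∫⁻ η, ∫⁻ ζ, ‖a (ζ + η) * Q ζ * b η‖ₑ ^ 2 := by
  refine lintegral_congr fun η => ?_
  rw [← lintegral_add_right_eq_self _ η]
  simp [sandwichKernel]

/-! ### The Fourier transform on `L²` is unitary -/

lemma fourierL2_adjoint_apply (f : L2) : fourierL2.adjoint f = 𝓕⁻ f := by
  refine ext_inner_left ℂ fun g => ?_
  rw [ContinuousLinearMap.adjoint_inner_right, fourierL2_apply, ← Lp.inner_fourier_eq g,
    fourier_fourierInv_eq]

lemma fourierL2_mul_adjoint : fourierL2 * fourierL2.adjoint = 1 := by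
  ext1 f
  rw [mul_apply_eq_comp, fourierL2_adjoint_apply, fourierL2_apply, fourier_fourierInv_eq]
  rfl

lemma norm_fourierL2_adjoint (f : L2) : ‖fourierL2.adjoint f‖ = ‖f‖ := by
  rw [fourierL2_adjoint_apply, ← Lp.norm_fourier_eq, fourier_fourierInv_eq]

lemma norm_fourierL2_le : ‖fourierL2‖ ≤ 1 :=
  ContinuousLinearMap.opNorm_le_bound _ zero_le_one fun f => by
    rw [fourierL2_apply, Lp.norm_fourier_eq, one_mul]

/-- `Λ` and `Γ` through operators `G₁`, `G₂` on the frequency side whose kernels are square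
integrable. -/
structure Factorization (ε κ : ℝ) (q : 𝓢'(ℝ, ℂ)) (Q : ℝ → ℂ) (N : ℝ) (G₁ G₂ : L2 →L[ℂ] L2) :
    Prop where
  nonneg : 0 ≤ N
  rows₁ : HasRows G₁ (rows (sandwichKernel (symMinus κ) (symPlus κ) Q))
  rows₂ : HasRows G₂ (rows (sandwichKernel (fun ξ => conj (symMinus κ ξ))
    (fun ξ => conj (symPlus κ ξ)) Q))
  bound₁ : ∫⁻ η, ∫⁻ ξ, ‖sandwichKernel (symMinus κ) (symPlus κ) Q η ξ‖ₑ ^ 2 ≤ ENNReal.ofReal N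
  bound₂ : ∫⁻ η, ∫⁻ ξ, ‖sandwichKernel (fun ξ => conj (symMinus κ ξ))
    (fun ξ => conj (symPlus κ ξ)) Q η ξ‖ₑ ^ 2 ≤ ENNReal.ofReal N
  lam_eq : Lam κ q = (G₁ * fourierL2).adjoint * fourierL2
  gam_eq : Gam ε κ q = (ε : ℂ) • ((G₂ * fourierL2).adjoint * fourierL2).adjoint
  lam_sandwich : ∃ T, IsSandwich (symMinus κ) (symPlus κ) q T
  gam_sandwich : ∃ T, IsSandwich (symPlus κ) (symMinus κ) (companion ε q) T

/-- Conjugation does not change the moduli of the symbols, so one `N` serves both kernels. -/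
theorem exists_factorization {s : ℝ} (hs : -(1 / 2) < s) (hs' : s < 0) :
    ∃ C : ℝ, 0 < C ∧ ∀ (ε : ℝ) (q : 𝓢'(ℝ, ℂ)) (Q : ℝ → ℂ), IsSymbol s q Q → ∀ κ : ℝ, 1 ≤ |κ| →
      ∃ G₁ G₂, Factorization ε κ q Q (C * |κ| ^ (-1 - 2 * s) * sobolevNorm s |κ| q ^ 2) G₁ G₂ := by
  obtain ⟨C, hC, hb⟩ := exists_hilbertSchmidt_bound hs hs'
  refine ⟨C, hC, fun ε q Q hQ κ hκ => ?_⟩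
  have hκ0 : κ ≠ 0 := abs_pos.mp (by linarith)
  have ha := isHalfSymbol_symMinus hκ0
  have hp := isHalfSymbol_symPlus hκ0
  have b1 := lintegral_sandwichKernel_eq.trans_le (hb q Q hQ κ hκ _ _ ha hp)
  have b2 := lintegral_sandwichKernel_eq.trans_le (hb q Q hQ κ hκ _ _ ha.conj hp.conj)
  have m1 := measurable_sandwichKernel ha.1 hp.1 hQ.measurable
  have m2 := measurable_sandwichKernel ha.conj.1 hp.conj.1 hQ.measurable
  obtain ⟨G₁, h1⟩ := exists_hasRows_rows m1 b1
  obtain ⟨G₂, h2⟩ := exists_hasRows_rows m2 b2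
  have s1 := isSandwich_of_hasRows hQ.measurable hQ.integrable_weighted hQ.apply_eq
    (ae_memLp_row m1 b1) h1
  have s2 := isSandwich_companion (ε := ε) (isSandwich_of_hasRows hQ.measurable
    hQ.integrable_weighted hQ.apply_eq (ae_memLp_row m2 b2) h2)
  have n1 : ∀ ξ, symMinus κ ξ ≠ 0 := fun ξ => ne_zero_of_norm_sq_eq hκ0 (ha.2 ξ)
  have n2 : ∀ ξ, symPlus κ ξ ≠ 0 := fun ξ => ne_zero_of_norm_sq_eq hκ0 (hp.2 ξ)
  have i1 := fun ξ => norm_inv_le_of_norm_sq_eq hκ0 (ha.2 ξ)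
  have i2 := fun ξ => norm_inv_le_of_norm_sq_eq hκ0 (hp.2 ξ)
  exact ⟨G₁, G₂, by positivity, h1, h2, b1, b2, s1.sandwich_eq ha.1 hp.1 n1 n2 i1 i2,
    s2.sandwich_eq hp.1 ha.1 n2 n1 i2 i1, ⟨_, s1⟩, ⟨_, s2⟩⟩

/-! ### Traces of the powers of `ΛΓ` -/

section

variable {ε κ N : ℝ} {q : 𝓢'(ℝ, ℂ)} {Q : ℝ → ℂ} {G₁ G₂ : L2 →L[ℂ] L2}

lemma Factorization.lam_mul_gam (h : Factorization ε κ q Q N G₁ G₂) :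
    Lam κ q * Gam ε κ q = (ε : ℂ) • ((G₁ * fourierL2).adjoint * (G₂ * fourierL2)) := by
  have e : ((G₂ * fourierL2).adjoint * fourierL2).adjoint = fourierL2.adjoint * (G₂ * fourierL2) := by
    change (((G₂ * fourierL2).adjoint).comp fourierL2).adjoint = _
    rw [ContinuousLinearMap.adjoint_comp, ContinuousLinearMap.adjoint_adjoint]
    rfl
  rw [h.lam_eq, h.gam_eq, e, mul_smul_comm, mul_assoc, ← mul_assoc fourierL2,
    fourierL2_mul_adjoint, one_mul]

/-- Splitting off one factor `ΛΓ` puts every power in the form `S† (T X)` required by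
`hasTrace_of_hasRows`. -/
lemma Factorization.lam_mul_gam_pow (h : Factorization ε κ q Q N G₁ G₂) (m : ℕ) :
    (Lam κ q * Gam ε κ q) ^ (m + 1) = (ε : ℂ) • ((G₁ * fourierL2).adjoint *
      ((G₂ * fourierL2) * (Lam κ q * Gam ε κ q) ^ m)) := by
  rw [pow_succ']
  nth_rewrite 1 [h.lam_mul_gam]
  rw [smul_mul_assoc, mul_assoc]

lemma HasTrace.const_smul {T : L2 →L[ℂ] L2} {c : ℂ} (h : HasTrace T c) (z : ℂ) :
    HasTrace (z • T) (z * c) := by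
  intro ι b
  simpa [inner_smul_right] using (h ι b).mul_left z

/-- The value of `tr ((ΛΓ)^(m+1))`. -/
def traceValue (ε κ : ℝ) (q : 𝓢'(ℝ, ℂ)) (Q : ℝ → ℂ) (m : ℕ) : ℂ :=
  ε * ∫ η, ⟪((Lam κ q * Gam ε κ q) ^ m).adjoint (fourierL2.adjoint
    (rows (sandwichKernel (fun ξ => conj (symMinus κ ξ)) (fun ξ => conj (symPlus κ ξ)) Q) η)),
    fourierL2.adjoint (rows (sandwichKernel (symMinus κ) (symPlus κ) Q) η)⟫_ℂ

lemma measurable_kernels (κ : ℝ) (hQ : Measurable Q) :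
    Measurable (Function.uncurry (sandwichKernel (symMinus κ) (symPlus κ) Q)) ∧
    Measurable (Function.uncurry (sandwichKernel (fun ξ => conj (symMinus κ ξ))
      (fun ξ => conj (symPlus κ ξ)) Q)) :=
  ⟨measurable_sandwichKernel (measurable_symMinus κ) (measurable_symPlus κ) hQ,
    measurable_sandwichKernel (Complex.continuous_conj.measurable.comp (measurable_symMinus κ))
      (Complex.continuous_conj.measurable.comp (measurable_symPlus κ)) hQ⟩

lemma Factorization.hasTrace (h : Factorization ε κ q Q N G₁ G₂) (hQ : Measurable Q) (m : ℕ) :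
    HasTrace ((Lam κ q * Gam ε κ q) ^ (m + 1)) (traceValue ε κ q Q m) := by
  obtain ⟨m1, m2⟩ := measurable_kernels κ hQ
  rw [h.lam_mul_gam_pow]
  refine HasTrace.const_smul ?_ _
  refine hasTrace_of_hasRows (h.rows₁.comp fourierL2) (h.rows₂.comp fourierL2) ?_ ?_ _
  · simpa only [norm_fourierL2_adjoint] using integrable_norm_sq_rows m1 h.bound₁
  · simpa only [norm_fourierL2_adjoint] using integrable_norm_sq_rows m2 h.bound₂

lemma Factorization.norm_lam_mul_gam_le (h : Factorization ε κ q Q N G₁ G₂) (hQ : Measurable Q)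
    (hε : |ε| = 1) : ‖Lam κ q * Gam ε κ q‖ ≤ N := by
  obtain ⟨m1, m2⟩ := measurable_kernels κ hQ
  have hG : ∀ (G : L2 →L[ℂ] L2) (K : ℝ → ℝ → ℂ), Measurable (Function.uncurry K) →
      ∫⁻ η, ∫⁻ ξ, ‖K η ξ‖ₑ ^ 2 ≤ ENNReal.ofReal N → HasRows G (rows K) →
      ‖G * fourierL2‖ ≤ Real.sqrt N := by
    intro G K hK hN hG
    have h1 : ‖G‖ ≤ Real.sqrt N := hG.norm_le (integrable_norm_sq_rows hK hN) (Real.sqrt_nonneg _)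
      ((integral_norm_sq_rows_le hK hN h.nonneg).trans_eq (Real.sq_sqrt h.nonneg).symm)
    calc ‖G * fourierL2‖ ≤ ‖G‖ * ‖fourierL2‖ := norm_mul_le _ _
      _ ≤ Real.sqrt N * 1 := by gcongr; exact norm_fourierL2_le
      _ = _ := mul_one _
  rw [h.lam_mul_gam, norm_smul, Complex.norm_real, Real.norm_eq_abs, hε, one_mul]
  calc _ ≤ ‖(G₁ * fourierL2).adjoint‖ * ‖G₂ * fourierL2‖ := norm_mul_le _ _
    _ ≤ Real.sqrt N * Real.sqrt N := by
      rw [LinearIsometryEquiv.norm_map]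
      gcongr
      · exact hG _ _ m1 h.bound₁ h.rows₁
      · exact hG _ _ m2 h.bound₂ h.rows₂
    _ = N := Real.mul_self_sqrt h.nonneg

lemma Factorization.norm_traceValue_le (h : Factorization ε κ q Q N G₁ G₂) (hQ : Measurable Q)
    (hε : |ε| = 1) (m : ℕ) : ‖traceValue ε κ q Q m‖ ≤ N ^ (m + 1) := by
  obtain ⟨m1, m2⟩ := measurable_kernels κ hQ
  rw [traceValue, norm_mul, Complex.norm_real, Real.norm_eq_abs, hε, one_mul]
  refine (norm_integral_inner_le (N := N) ?_ ?_ ?_ ?_ _).trans ?_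
  · simpa only [norm_fourierL2_adjoint] using integrable_norm_sq_rows m1 h.bound₁
  · simpa only [norm_fourierL2_adjoint] using integrable_norm_sq_rows m2 h.bound₂
  · simpa only [norm_fourierL2_adjoint] using integral_norm_sq_rows_le m1 h.bound₁ h.nonneg
  · simpa only [norm_fourierL2_adjoint] using integral_norm_sq_rows_le m2 h.bound₂ h.nonneg
  · rw [pow_succ]
    have h0 := h.nonneg
    gcongr
    -- For `m = 0` the power is the identity, whose norm is bounded separately.
    rcases m with _ | m
    · exact ContinuousLinearMap.norm_id_le
    · exact (norm_pow_le' _ m.succ_pos).trans (by gcongr; exact h.norm_lam_mul_gam_le hQ hε)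

/-- `tr (ΛΓ) = ± ∫ |q̂|² / (2κ - 2πiζ)`. -/
lemma Factorization.traceValue_zero (h : Factorization ε κ q Q N G₁ G₂) (hQ : Measurable Q)
    (hκ : 0 < κ) :
    traceValue ε κ q Q 0 = ε * ∫ ζ : ℝ, ((‖Q ζ‖ ^ 2 : ℝ) : ℂ) *
      (2 * κ - 2 * π * ζ * Complex.I)⁻¹ := by
  obtain ⟨m1, m2⟩ := measurable_kernels κ hQ
  have ha := measurable_symMinus κ
  have hb := measurable_symPlus κ
  have hshear : Measurable (Function.uncurry fun η ζ => symMinus κ (ζ + η) * Q ζ * symPlus κ η) := by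
    have h : Measurable fun p : ℝ × ℝ => symMinus κ (p.2 + p.1) * Q p.2 * symPlus κ p.1 := by
      fun_prop
    exact h
  have hint : Integrable (Function.uncurry fun η ζ : ℝ =>
      ((‖Q ζ‖ ^ 2 : ℝ) : ℂ) * (symMinus κ (ζ + η) ^ 2 * symPlus κ η ^ 2))
      (volume.prod volume) := by
    refine (integrable_kernel_sq hshear (lintegral_sandwichKernel_eq ▸ h.bound₁)).mono' ?_
      (ae_of_all _ fun p => le_of_eq ?_)
    · have h : Measurable fun p : ℝ × ℝ => ((‖Q p.2‖ ^ 2 : ℝ) : ℂ) *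
          (symMinus κ (p.2 + p.1) ^ 2 * symPlus κ p.1 ^ 2) := by fun_prop
      exact h.aestronglyMeasurable
    · obtain ⟨η, ζ⟩ := p
      simp only [Function.uncurry_apply_pair, norm_mul, norm_pow, Complex.norm_real, norm_norm]
      ring
  rw [traceValue]
  congr 1
  calc _ = ∫ η : ℝ, ∫ ζ : ℝ, ((‖Q ζ‖ ^ 2 : ℝ) : ℂ) *
        (symMinus κ (ζ + η) ^ 2 * symPlus κ η ^ 2) := by
        refine integral_congr_ae ?_
        filter_upwards [ae_memLp_row m1 h.bound₁, ae_memLp_row m2 h.bound₂] with η h1 h2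
        have hX : ((Lam κ q * Gam ε κ q) ^ 0).adjoint = 1 := by
          rw [pow_zero]
          exact ContinuousLinearMap.adjoint_id
        rw [hX, one_apply_eq_self, ContinuousLinearMap.adjoint_inner_right,
          ← mul_apply_eq_comp, fourierL2_mul_adjoint, one_apply_eq_self,
          inner_rows_rows h2 h1, ← integral_add_right_eq_self _ η]
        congr 1
        funext ζ
        -- The second kernel carries conjugated symbols, so the pairing produces squares rather than
        -- moduli of the symbols; these squares are rational functions.
        simp only [sandwichKernel, map_mul, Complex.conj_conj, add_sub_cancel_right]
        rw [Complex.ofReal_pow, ← Complex.conj_mul']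
        ring
    _ = ∫ ζ : ℝ, ∫ η : ℝ, ((‖Q ζ‖ ^ 2 : ℝ) : ℂ) *
        (symMinus κ (ζ + η) ^ 2 * symPlus κ η ^ 2) := integral_integral_swap hint
    _ = _ := by
        congr 1
        funext ζ
        rw [integral_const_mul, ← integral_symbol_mul hκ ζ]
        simp_rw [symMinus_sq hκ.ne', symPlus_sq hκ.ne', Complex.ofReal_add]

end

/-! ### Weakly measurable families of operators -/

/-- All matrix coefficients of the family `T` are measurable. -/
def WeaklyMeasurable (T : ℝ → L2 →L[ℂ] L2) (μ : Measure ℝ) : Prop :=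
  ∀ f g : L2, AEStronglyMeasurable (fun ϰ => ⟪f, T ϰ g⟫_ℂ) μ

lemma aestronglyMeasurable_of_hasSum {ι : Type*} [Countable ι] {μ : Measure ℝ} {F : ι → ℝ → ℂ}
    {f : ℝ → ℂ} (hF : ∀ i, AEStronglyMeasurable (F i) μ)
    (h : ∀ᵐ ϰ ∂μ, HasSum (fun i => F i ϰ) (f ϰ)) : AEStronglyMeasurable f μ :=
  aestronglyMeasurable_of_tendsto_ae Filter.atTop (f := fun s : Finset ι => fun ϰ => ∑ i ∈ s, F i ϰ)
    (fun s => Finset.aestronglyMeasurable_fun_sum s fun i _ => hF i) h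

/-- A matrix coefficient of the product is, by Parseval in a countable basis, a series of products
of coefficients. -/
lemma WeaklyMeasurable.mul {S T : ℝ → L2 →L[ℂ] L2} {μ : Measure ℝ} (hS : WeaklyMeasurable S μ)
    (hT : WeaklyMeasurable T μ) : WeaklyMeasurable (fun ϰ => S ϰ * T ϰ) μ := by
  intro f g
  obtain ⟨w, b, -⟩ := exists_hilbertBasis ℂ L2
  have := hilbertBasis_countable b
  refine aestronglyMeasurable_of_hasSum (F := fun i ϰ => ⟪f, S ϰ (b i)⟫_ℂ * ⟪b i, T ϰ g⟫_ℂ)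
    (fun i => (hS f (b i)).mul (hT (b i) g)) (ae_of_all _ fun ϰ => ?_)
  have h := b.hasSum_inner_mul_inner ((S ϰ).adjoint f) (T ϰ g)
  simpa only [ContinuousLinearMap.adjoint_inner_left, mul_apply_eq_comp] using h

lemma WeaklyMeasurable.pow {T : ℝ → L2 →L[ℂ] L2} {μ : Measure ℝ} (hT : WeaklyMeasurable T μ)
    (n : ℕ) : WeaklyMeasurable (fun ϰ => T ϰ ^ n) μ := by
  induction n with
  | zero => exact fun f g => by simpa using aestronglyMeasurable_const
  | succ n ih =>
    simp_rw [pow_succ]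
    exact ih.mul hT

lemma WeaklyMeasurable.aestronglyMeasurable_trace {T : ℝ → L2 →L[ℂ] L2} {μ : Measure ℝ}
    (hT : WeaklyMeasurable T μ) {c : ℝ → ℂ} (h : ∀ᵐ ϰ ∂μ, HasTrace (T ϰ) (c ϰ)) :
    AEStronglyMeasurable c μ := by
  obtain ⟨w, b, -⟩ := exists_hilbertBasis ℂ L2
  have := hilbertBasis_countable b
  refine aestronglyMeasurable_of_hasSum (F := fun i ϰ => ⟪b i, T ϰ (b i)⟫_ℂ)
    (fun i => hT _ _) ?_
  filter_upwards [h] with ϰ hϰ using hϰ _ b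

lemma inner_eq_of_hasRows {K : ℝ → ℝ → ℂ} {G : L2 →L[ℂ] L2} (hG : HasRows G (rows K))
    (hK : ∀ᵐ η, MemLp (K η) 2 (volume : Measure ℝ)) (f g : L2) :
    ⟪G f, g⟫_ℂ = ∫ η, conj (∫ ξ, conj (K η ξ) * f ξ) * g η := by
  rw [L2.inner_def]
  refine integral_congr_ae ?_
  filter_upwards [hG f, hK] with η h1 h2
  rw [h1, inner_rows h2, RCLike.inner_apply, mul_comm]

lemma measurable_kernel_pairing {K : ℝ → ℝ → ℝ → ℂ}
    (hK : Measurable fun p : (ℝ × ℝ) × ℝ => K p.1.1 p.1.2 p.2) (f g : L2) :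
    StronglyMeasurable fun ϰ => ∫ η, conj (∫ ξ, conj (K ϰ η ξ) * f ξ) * g η := by
  have hf := (Lp.stronglyMeasurable f).measurable
  have hg := (Lp.stronglyMeasurable g).measurable
  have h1 : StronglyMeasurable fun p : ℝ × ℝ => ∫ ξ, conj (K p.1 p.2 ξ) * f ξ :=
    StronglyMeasurable.integral_prod_right'
      (f := fun p : (ℝ × ℝ) × ℝ => conj (K p.1.1 p.1.2 p.2) * f p.2)
      ((Complex.continuous_conj.measurable.comp hK).mul
        (hf.comp measurable_snd)).stronglyMeasurable
  exact StronglyMeasurable.integral_prod_right'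
    (f := fun p : ℝ × ℝ => conj (∫ ξ, conj (K p.1 p.2 ξ) * f ξ) * g p.2)
    ((Complex.continuous_conj.measurable.comp h1.measurable).mul
      (hg.comp measurable_snd)).stronglyMeasurable

/-- The leading term of `α`. -/
def leadingTerm (κ : ℝ) (Q : ℝ → ℂ) : ℝ := ∫ ζ, ‖Q ζ‖ ^ 2 * (2 * κ / wt κ ζ)

/-! ### Measurability in the spectral parameter and the series for `A` -/

section

variable {s ε : ℝ} {q : 𝓢'(ℝ, ℂ)} {Q : ℝ → ℂ}

/-- `Lam` and `Gam` are chosen separately for each parameter, so measurability must come from the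
factorization, which writes their coefficients as parametric integrals of jointly measurable
functions. -/
lemma weaklyMeasurable_lam_mul_gam {C : ℝ} (hQ : Measurable Q) {κ₀ : ℝ} (hκ₀ : 1 ≤ κ₀)
    (hfac : ∀ κ : ℝ, 1 ≤ |κ| →
      ∃ G₁ G₂, Factorization ε κ q Q (C * |κ| ^ (-1 - 2 * s) * sobolevNorm s |κ| q ^ 2) G₁ G₂) :
    WeaklyMeasurable (fun κ => Lam κ q * Gam ε κ q) (volume.restrict (Ioi κ₀)) := by
  have ha := measurable_symMinus_uncurry
  have hb := measurable_symPlus_uncurry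
  have hκ : ∀ κ ∈ Ioi κ₀, 1 ≤ |κ| := fun κ hκ => (hκ₀.trans (le_of_lt hκ)).trans (le_abs_self κ)
  refine WeaklyMeasurable.mul ?_ ?_
  · intro f g
    have hm := measurable_kernel_pairing
      (K := fun κ η ξ => sandwichKernel (symMinus κ) (symPlus κ) Q η ξ) (by
        have h1 : Measurable fun p : (ℝ × ℝ) × ℝ => symMinus p.1.1 p.2 :=
          ha.comp (by fun_prop : Measurable fun p : (ℝ × ℝ) × ℝ => (p.1.1, p.2))
        have h2 : Measurable fun p : (ℝ × ℝ) × ℝ => symPlus p.1.1 p.1.2 := hb.comp measurable_fst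
        have h3 : Measurable fun p : (ℝ × ℝ) × ℝ => Q (p.2 - p.1.2) := by fun_prop
        exact (h1.mul h3).mul h2) (fourierL2 f) (fourierL2 g)
    refine hm.aestronglyMeasurable.congr ?_
    refine (ae_restrict_iff' measurableSet_Ioi).mpr (ae_of_all _ fun κ hκ' => ?_)
    obtain ⟨G₁, G₂, h⟩ := hfac κ (hκ κ hκ')
    beta_reduce
    rw [h.lam_eq, mul_apply_eq_comp, ContinuousLinearMap.adjoint_inner_right, mul_apply_eq_comp,
      inner_eq_of_hasRows h.rows₁ (ae_memLp_row (measurable_kernels κ hQ).1 h.bound₁)]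
  · intro f g
    have hm := measurable_kernel_pairing
      (K := fun κ η ξ => sandwichKernel (fun ξ => conj (symMinus κ ξ))
        (fun ξ => conj (symPlus κ ξ)) Q η ξ) (by
        have h1 : Measurable fun p : (ℝ × ℝ) × ℝ => conj (symMinus p.1.1 p.2) :=
          Complex.continuous_conj.measurable.comp
            (ha.comp (by fun_prop : Measurable fun p : (ℝ × ℝ) × ℝ => (p.1.1, p.2)))
        have h2 : Measurable fun p : (ℝ × ℝ) × ℝ => conj (symPlus p.1.1 p.1.2) :=
          Complex.continuous_conj.measurable.comp (hb.comp measurable_fst)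
        have h3 : Measurable fun p : (ℝ × ℝ) × ℝ => Q (p.2 - p.1.2) := by fun_prop
        exact (h1.mul h3).mul h2) (fourierL2 g) (fourierL2 f)
    have hm' : AEStronglyMeasurable _ (volume.restrict (Ioi κ₀)) :=
      ((Complex.continuous_conj.comp_stronglyMeasurable hm).const_mul
        (ε : ℂ)).aestronglyMeasurable
    refine hm'.congr ?_
    refine (ae_restrict_iff' measurableSet_Ioi).mpr (ae_of_all _ fun κ hκ' => ?_)
    obtain ⟨G₁, G₂, h⟩ := hfac κ (hκ κ hκ')
    beta_reduce
    rw [h.gam_eq, smul_apply, inner_smul_right, ContinuousLinearMap.adjoint_inner_right,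
      mul_apply_eq_comp, ContinuousLinearMap.adjoint_inner_left, mul_apply_eq_comp,
      ← inner_conj_symm,
      inner_eq_of_hasRows h.rows₂ (ae_memLp_row (measurable_kernels κ hQ).2 h.bound₂)]

variable {κ N : ℝ} {G₁ G₂ : L2 →L[ℂ] L2}

lemma Factorization.logDetTerm_eq (h : Factorization ε κ q Q N G₁ G₂) (hQ : Measurable Q) (m : ℕ) :
    logDetTerm ε κ q m = (-1) ^ m / ((m : ℂ) + 1) * traceValue ε κ q Q m := by
  rw [logDetTerm, (h.hasTrace hQ m).tr_eq]

lemma norm_neg_one_pow_div (m : ℕ) : ‖((-1) ^ m / ((m : ℂ) + 1) : ℂ)‖ = 1 / ((m : ℝ) + 1) := by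
  rw [norm_div, norm_pow, norm_neg, norm_one, one_pow]
  congr 1
  have : ((m : ℂ) + 1) = ((m + 1 : ℝ) : ℂ) := by push_cast; rfl
  rw [this, Complex.norm_real, Real.norm_of_nonneg (by positivity)]

lemma Factorization.norm_logDetTerm_le (h : Factorization ε κ q Q N G₁ G₂) (hQ : Measurable Q)
    (hε : |ε| = 1) (m : ℕ) : ‖logDetTerm ε κ q m‖ ≤ 1 / ((m : ℝ) + 1) * N ^ (m + 1) := by
  rw [h.logDetTerm_eq hQ, norm_mul, norm_neg_one_pow_div]
  gcongr
  exact h.norm_traceValue_le hQ hε m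

lemma Factorization.summable (h : Factorization ε κ q Q N G₁ G₂) (hQ : Measurable Q)
    (hε : |ε| = 1) (hN : N ≤ 1 / 2) : Summable fun m => ‖logDetTerm ε κ q m‖ := by
  have h0 := h.nonneg
  have hg : Summable fun m : ℕ => N ^ (m + 1) :=
    (summable_nat_add_iff 1).mpr (summable_geometric_of_lt_one h0 (by linarith))
  refine Summable.of_nonneg_of_le (fun m => norm_nonneg _) (fun m => ?_) hg
  refine (h.norm_logDetTerm_le hQ hε m).trans (mul_le_of_le_one_left (by positivity) ?_)
  rw [div_le_one (by positivity)]
  have : (0 : ℝ) ≤ m := Nat.cast_nonneg m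
  linarith

lemma Factorization.aDefined (h : Factorization ε κ q Q N G₁ G₂) (hQ : Measurable Q)
    (hε : |ε| = 1) (hN : N ≤ 1 / 2) : ADefined ε κ q :=
  ⟨h.lam_sandwich, h.gam_sandwich, fun m => ⟨_, h.hasTrace hQ m⟩, h.summable hQ hε hN⟩

lemma wt_eq_mul (κ ζ : ℝ) : ((wt κ ζ : ℝ) : ℂ) =
    (2 * κ - 2 * π * ζ * Complex.I) * (2 * κ + 2 * π * ζ * Complex.I) := by
  unfold wt
  push_cast
  ring_nf
  rw [Complex.I_sq]
  ring

lemma inv_symbol_eq {κ : ℝ} (hκ : 0 < κ) (ζ : ℝ) : (2 * κ - 2 * π * ζ * Complex.I : ℂ)⁻¹ =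
    (((2 * κ / wt κ ζ : ℝ) : ℂ) + ((2 * π * ζ / wt κ ζ : ℝ) : ℂ) * Complex.I) := by
  have h0 : (2 * κ - 2 * π * ζ * Complex.I : ℂ) ≠ 0 :=
    fun h => hκ.ne' (by simpa using congrArg Complex.re h)
  have h1 : (2 * κ + 2 * π * ζ * Complex.I : ℂ) ≠ 0 :=
    fun h => hκ.ne' (by simpa using congrArg Complex.re h)
  push_cast
  rw [wt_eq_mul, div_mul_eq_mul_div, ← add_div, eq_div_iff (mul_ne_zero h0 h1), ← mul_assoc,
    inv_mul_cancel₀ h0, one_mul]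

/-- The factor has modulus `wt^(-1/2)`, which is at most `wt^s` as `wt ≥ 1` and `s > -1/2`. -/
lemma IsSymbol.integrable_leading (hs : -(1 / 2) < s) (hQ : IsSymbol s q Q) (hκ : 1 ≤ κ) :
    Integrable fun ζ : ℝ => ((‖Q ζ‖ ^ 2 : ℝ) : ℂ) * (2 * κ - 2 * π * ζ * Complex.I)⁻¹ := by
  have hQm := hQ.measurable
  refine (hQ.integrable_sq κ hκ).mono' ?_ (ae_of_all _ fun ζ => ?_)
  · have : Measurable fun ζ : ℝ => ((‖Q ζ‖ ^ 2 : ℝ) : ℂ) *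
      (2 * κ - 2 * π * ζ * Complex.I)⁻¹ := by fun_prop
    exact this.aestronglyMeasurable
  · have hw := wt_pos (show κ ≠ 0 by linarith) ζ
    have hw1 : 1 ≤ wt κ ζ := le_trans (by nlinarith [sq_nonneg ζ]) (one_add_sq_le_wt hκ ζ)
    rw [norm_mul, Complex.norm_real, Real.norm_of_nonneg (by positivity)]
    gcongr
    have h1 : ‖(2 * κ - 2 * π * ζ * Complex.I : ℂ)‖ = wt κ ζ ^ (1 / 2 : ℝ) := by
      have : (2 * κ - 2 * π * ζ * Complex.I : ℂ) =
        ((2 * κ : ℝ) : ℂ) + ((-(2 * π * ζ) : ℝ) : ℂ) * Complex.I := by push_cast; ring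
      rw [this, Complex.norm_add_mul_I, Real.sqrt_eq_rpow]
      unfold wt
      ring_nf
    rw [norm_inv, h1, ← Real.rpow_neg hw.le]
    exact Real.rpow_le_rpow_of_exponent_le hw1 (by linarith)

lemma Factorization.re_traceValue_zero (h : Factorization ε κ q Q N G₁ G₂) (hs : -(1 / 2) < s)
    (hQ : IsSymbol s q Q) (hε : ε * ε = 1) (hκ : 1 ≤ κ) :
    ε * (traceValue ε κ q Q 0).re = leadingTerm κ Q := by
  have hκ0 : 0 < κ := by linarith
  rw [h.traceValue_zero hQ.measurable hκ0, Complex.re_ofReal_mul, ← mul_assoc, hε, one_mul]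
  have h1 := Complex.reCLM.integral_comp_comm (hQ.integrable_leading hs hκ)
  simp only [Complex.reCLM_apply] at h1
  rw [← h1, leadingTerm]
  congr 1
  funext ζ
  rw [Complex.re_ofReal_mul, inv_symbol_eq hκ0]
  simp

/-- The terms with `m ≥ 2` of the series for `A` are quadratically small. -/
lemma Factorization.abs_alpha_sub_le (h : Factorization ε κ q Q N G₁ G₂) (hs : -(1 / 2) < s)
    (hQ : IsSymbol s q Q) (hε : |ε| = 1) (hκ : 1 ≤ κ) (hN : N ≤ 1 / 2) :
    |alpha ε κ q - leadingTerm κ Q| ≤ N ^ 2 := by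
  have h0 := h.nonneg
  have hsum := h.summable hQ.measurable hε hN
  have hεε : ε * ε = 1 := by rw [← abs_mul_abs_self, hε, one_mul]
  have h1 : A ε κ q = traceValue ε κ q Q 0 + ∑' m, logDetTerm ε κ q (m + 1) := by
    rw [A, Real.sign_of_pos (by linarith), Complex.ofReal_one, one_mul,
      hsum.of_norm.tsum_eq_zero_add, h.logDetTerm_eq hQ.measurable 0]
    simp
  have h2 : ‖∑' m, logDetTerm ε κ q (m + 1)‖ ≤ N ^ 2 := by
    -- The coefficients `1/(m+2)` are at most `1/2`, which offsets `(1 - N)⁻¹ ≤ 2`.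
    have hg := (hasSum_geometric_of_lt_one h0 (by linarith : N < 1)).mul_left (1 / 2 * N ^ 2)
    refine (tsum_of_norm_bounded hg fun m => ?_).trans ?_
    · refine (h.norm_logDetTerm_le hQ.measurable hε (m + 1)).trans ?_
      rw [mul_assoc, ← pow_add, add_comm 2 m]
      have : (0 : ℝ) ≤ m := Nat.cast_nonneg m
      gcongr
      push_cast
      linarith
    · have h3 : (1 - N)⁻¹ ≤ 2 := by
        rw [inv_le_comm₀ (by linarith) (by norm_num)]
        linarith
      nlinarith [sq_nonneg N]
  rw [alpha, h1, Complex.add_re, mul_add, h.re_traceValue_zero hs hQ hεε hκ, add_sub_cancel_left,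
    abs_mul, hε, one_mul]
  exact (Complex.abs_re_le_norm _).trans h2

lemma aestronglyMeasurable_alpha {C : ℝ} (hQ : Measurable Q) (hε : |ε| = 1) {κ₀ : ℝ} (hκ₀ : 1 ≤ κ₀)
    (hfac : ∀ κ : ℝ, 1 ≤ |κ| →
      ∃ G₁ G₂, Factorization ε κ q Q (C * |κ| ^ (-1 - 2 * s) * sobolevNorm s |κ| q ^ 2) G₁ G₂)
    (hN : ∀ κ : ℝ, 1 ≤ |κ| → C * |κ| ^ (-1 - 2 * s) * sobolevNorm s |κ| q ^ 2 ≤ 1 / 2) :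
    AEStronglyMeasurable (fun κ => alpha ε κ q) (volume.restrict (Ioi κ₀)) := by
  have hW := weaklyMeasurable_lam_mul_gam hQ hκ₀ hfac
  have hκ : ∀ κ ∈ Ioi κ₀, 1 ≤ |κ| := fun κ hκ => (hκ₀.trans (le_of_lt hκ)).trans (le_abs_self κ)
  have hterm : ∀ m, AEStronglyMeasurable (fun κ => logDetTerm ε κ q m)
      (volume.restrict (Ioi κ₀)) := by
    intro m
    refine AEStronglyMeasurable.const_mul ?_ _
    refine (hW.pow (m + 1)).aestronglyMeasurable_trace ?_
    refine (ae_restrict_iff' measurableSet_Ioi).mpr (ae_of_all _ fun κ hκ' => ?_)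
    obtain ⟨G₁, G₂, h⟩ := hfac κ (hκ κ hκ')
    have := h.hasTrace hQ m
    rwa [← this.tr_eq] at this
  have hsum : AEStronglyMeasurable (fun κ => ∑' m, logDetTerm ε κ q m)
      (volume.restrict (Ioi κ₀)) := by
    refine aestronglyMeasurable_of_hasSum hterm ?_
    refine (ae_restrict_iff' measurableSet_Ioi).mpr (ae_of_all _ fun κ hκ' => ?_)
    obtain ⟨G₁, G₂, h⟩ := hfac κ (hκ κ hκ')
    exact (h.summable hQ hε (hN κ (hκ κ hκ'))).of_norm.hasSum
  have hA : AEStronglyMeasurable (fun κ => A ε κ q) (volume.restrict (Ioi κ₀)) := by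
    refine hsum.congr ((ae_restrict_iff' measurableSet_Ioi).mpr (ae_of_all _ fun κ hκ' => ?_))
    have : 0 < κ := by linarith [mem_Ioi.mp hκ']
    simp [A, Real.sign_of_pos this]
  exact (Complex.continuous_re.comp_aestronglyMeasurable hA).const_mul ε

end

/-! ### The two-sided energy estimate -/

lemma sobolevNorm_nonneg (s κ : ℝ) (q : 𝓢'(ℝ, ℂ)) : 0 ≤ sobolevNorm s κ q := by
  unfold sobolevNorm
  split_ifs
  · exact norm_nonneg _
  · exact le_rfl

lemma IsSymbol.sobolevNorm_sq_anti {s : ℝ} (hs' : s < 0) {q : 𝓢'(ℝ, ℂ)} {Q : ℝ → ℂ}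
    (hQ : IsSymbol s q Q) {κ ϰ : ℝ} (hκ : 1 ≤ κ) (h : κ ≤ ϰ) :
    sobolevNorm s ϰ q ^ 2 ≤ sobolevNorm s κ q ^ 2 := by
  rw [hQ.norm_sq _ hκ, hQ.norm_sq _ (hκ.trans h)]
  refine integral_mono (hQ.integrable_sq _ (hκ.trans h)) (hQ.integrable_sq _ hκ) fun ζ => ?_
  have hw := wt_pos (show κ ≠ 0 by linarith) ζ
  exact mul_le_mul_of_nonneg_left (Real.rpow_le_rpow_of_nonpos hw
    (wt_mono (by linarith) h ζ) hs'.le) (by positivity)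

/-- Fubini moves the `ϰ`-integral inside, where `exists_energy_bounds` applies to each frequency
separately. -/
theorem leadingTerm_energy {s : ℝ} (hs : -(1 / 2) < s) (hs' : s < 0) :
    ∃ c > 0, ∃ C > 0, ∀ (q : 𝓢'(ℝ, ℂ)) (Q : ℝ → ℂ), IsSymbol s q Q → ∀ κ : ℝ, 1 ≤ κ →
      IntegrableOn (fun ϰ : ℝ => ϰ ^ (2 * s + 1) * leadingTerm ϰ Q / ϰ) (Ioi κ) ∧
      c * sobolevNorm s κ q ^ 2 ≤ ∫ ϰ in Ioi κ, ϰ ^ (2 * s + 1) * leadingTerm ϰ Q / ϰ ∧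
      ∫ ϰ in Ioi κ, ϰ ^ (2 * s + 1) * leadingTerm ϰ Q / ϰ ≤ C * sobolevNorm s κ q ^ 2 := by
  obtain ⟨c, hc, C, hC, hb⟩ := exists_energy_bounds hs hs'
  refine ⟨c, hc, C, hC, fun q Q hQ κ hκ => ?_⟩
  have hQm := hQ.measurable
  set j : ℝ → ℝ → ℝ := fun ϰ ζ => ϰ ^ (2 * s + 1) * (2 * ϰ / wt ϰ ζ) / ϰ with hj
  have hwm : Measurable fun p : ℝ × ℝ => wt p.1 p.2 := by unfold wt; fun_prop
  have hjm : Measurable fun p : ℝ × ℝ => ‖Q p.2‖ ^ 2 * j p.1 p.2 := by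
    rw [hj]; fun_prop
  have hj0 : ∀ ϰ ∈ Ioi κ, ∀ ζ, 0 ≤ j ϰ ζ := by
    intro ϰ hϰ ζ
    have h0 : 0 < ϰ := by linarith [mem_Ioi.mp hϰ]
    have := wt_pos h0.ne' ζ
    rw [hj]
    positivity
  have hJ0 : ∀ ζ, 0 ≤ ∫ ϰ in Ioi κ, j ϰ ζ := fun ζ =>
    setIntegral_nonneg measurableSet_Ioi fun ϰ hϰ => hj0 ϰ hϰ ζ
  have hJm : StronglyMeasurable fun ζ => ∫ ϰ in Ioi κ, j ϰ ζ :=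
    StronglyMeasurable.integral_prod_left' (f := fun p : ℝ × ℝ => j p.1 p.2)
      (by rw [hj]; exact Measurable.stronglyMeasurable (by fun_prop))
  have hQJ : Integrable fun ζ => ‖Q ζ‖ ^ 2 * ∫ ϰ in Ioi κ, j ϰ ζ := by
    refine ((hQ.integrable_sq κ hκ).const_mul C).mono'
      ((hQm.norm.pow_const 2).mul hJm.measurable).aestronglyMeasurable (ae_of_all _ fun ζ => ?_)
    rw [Real.norm_of_nonneg (mul_nonneg (by positivity) (hJ0 ζ))]
    calc ‖Q ζ‖ ^ 2 * ∫ ϰ in Ioi κ, j ϰ ζ ≤ ‖Q ζ‖ ^ 2 * (C * wt κ ζ ^ s) := by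
          gcongr
          exact (hb κ hκ ζ).2.2
      _ = _ := by ring
  have hint : Integrable (fun p : ℝ × ℝ => ‖Q p.2‖ ^ 2 * j p.1 p.2)
      ((volume.restrict (Ioi κ)).prod volume) := by
    rw [integrable_prod_iff' hjm.aestronglyMeasurable]
    refine ⟨ae_of_all _ fun ζ => Integrable.const_mul (hb κ hκ ζ).1 (‖Q ζ‖ ^ 2), hQJ.congr (ae_of_all _ fun ζ => ?_)⟩
    simp only
    rw [← integral_const_mul]
    refine setIntegral_congr_fun measurableSet_Ioi fun ϰ hϰ => ?_
    exact (Real.norm_of_nonneg (mul_nonneg (by positivity) (hj0 ϰ hϰ ζ))).symm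
  have hlead : ∀ ϰ, ϰ ^ (2 * s + 1) * leadingTerm ϰ Q / ϰ = ∫ ζ, ‖Q ζ‖ ^ 2 * j ϰ ζ := by
    intro ϰ
    rw [leadingTerm, ← integral_const_mul, ← integral_div]
    congr 1
    funext ζ
    rw [hj]
    ring
  have hval : ∫ ϰ in Ioi κ, ϰ ^ (2 * s + 1) * leadingTerm ϰ Q / ϰ
      = ∫ ζ, ‖Q ζ‖ ^ 2 * ∫ ϰ in Ioi κ, j ϰ ζ := by
    simp_rw [hlead]
    rw [integral_integral_swap hint]
    simp_rw [integral_const_mul]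
  refine ⟨?_, ?_, ?_⟩
  · rw [IntegrableOn]
    simp_rw [hlead]
    exact hint.integral_prod_left
  · rw [hval, hQ.norm_sq κ hκ, ← integral_const_mul]
    refine integral_mono ((hQ.integrable_sq κ hκ).const_mul c) hQJ fun ζ => ?_
    calc c * (‖Q ζ‖ ^ 2 * wt κ ζ ^ s) = ‖Q ζ‖ ^ 2 * (c * wt κ ζ ^ s) := by ring
      _ ≤ _ := by
        gcongr
        exact (hb κ hκ ζ).2.1
  · rw [hval, hQ.norm_sq κ hκ, ← integral_const_mul]
    refine integral_mono hQJ ((hQ.integrable_sq κ hκ).const_mul C) fun ζ => ?_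
    calc ‖Q ζ‖ ^ 2 * ∫ ϰ in Ioi κ, j ϰ ζ ≤ ‖Q ζ‖ ^ 2 * (C * wt κ ζ ^ s) := by
          gcongr
          exact (hb κ hκ ζ).2.2
      _ = _ := by ring

/-- The leading term is coercive with constant `c`; the remainder is quadratic in the squared norm,
hence costs at most half of `c` on a small ball. -/
theorem energy_estimate {s : ℝ} (hs : -(1 / 2) < s) (hs' : s < 0) {ε : ℝ} (hε : |ε| = 1) :
    ∃ δ > 0, ∃ C > 0, ∀ q ∈ ball s δ,
      (∀ ϰ : ℝ, 1 ≤ |ϰ| → ADefined ε ϰ q) ∧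
      ∀ κ : ℝ, 1 ≤ κ →
        IntegrableOn (fun ϰ : ℝ => ϰ ^ (2 * s + 1) * alpha ε ϰ q / ϰ) (Ioi κ) ∧
        C⁻¹ * sobolevNorm s κ q ^ 2 ≤ ∫ ϰ in Ioi κ, ϰ ^ (2 * s + 1) * alpha ε ϰ q / ϰ ∧
        ∫ ϰ in Ioi κ, ϰ ^ (2 * s + 1) * alpha ε ϰ q / ϰ ≤ C * sobolevNorm s κ q ^ 2 := by
  obtain ⟨D, hD, hfac⟩ := exists_factorization hs hs'
  obtain ⟨c, hc, C, hC, hlead⟩ := leadingTerm_energy hs hs'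
  have hs1 : 0 < 1 + 2 * s := by linarith
  -- The first entry gives `N ≤ 1/2` for all `|κ| ≥ 1`; the second makes the integrated remainder at
  -- most `c/2` times the squared norm.
  set d := min (1 / (2 * D)) (c * (1 + 2 * s) / (2 * D ^ 2)) with hd
  have hd0 : 0 < d := by positivity
  have hd1 : D * d ≤ 1 / 2 := by
    calc D * d ≤ D * (1 / (2 * D)) := by gcongr; exact min_le_left _ _
      _ = 1 / 2 := by field_simp
  have hd2 : D ^ 2 * d / (1 + 2 * s) ≤ c / 2 := by
    calc D ^ 2 * d / (1 + 2 * s) ≤ D ^ 2 * (c * (1 + 2 * s) / (2 * D ^ 2)) / (1 + 2 * s) := by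
          gcongr; exact min_le_right _ _
      _ = c / 2 := by field_simp
  refine ⟨Real.sqrt d, Real.sqrt_pos.mpr hd0, max (2 / c) (C + c / 2), by positivity, ?_⟩
  rintro q ⟨hqm, hqn⟩
  obtain ⟨Q, hQ⟩ := exists_isSymbol hs hs' hqm
  have hn1 : sobolevNorm s 1 q ^ 2 ≤ d := by
    calc sobolevNorm s 1 q ^ 2 ≤ Real.sqrt d ^ 2 :=
          pow_le_pow_left₀ (sobolevNorm_nonneg _ _ _) hqn 2
      _ = d := Real.sq_sqrt hd0.le
  have hn : ∀ κ, 1 ≤ κ → sobolevNorm s κ q ^ 2 ≤ d := fun κ hκ =>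
    (hQ.sobolevNorm_sq_anti hs' le_rfl hκ).trans hn1
  have hN : ∀ κ : ℝ, 1 ≤ |κ| → D * |κ| ^ (-1 - 2 * s) * sobolevNorm s |κ| q ^ 2 ≤ 1 / 2 := by
    intro κ hκ
    have h1 : |κ| ^ (-1 - 2 * s) ≤ 1 := Real.rpow_le_one_of_one_le_of_nonpos hκ (by linarith)
    calc D * |κ| ^ (-1 - 2 * s) * sobolevNorm s |κ| q ^ 2 ≤ D * 1 * d := by
          gcongr
          exact hn _ hκ
      _ ≤ 1 / 2 := by rwa [mul_one]
  have hfacq := hfac ε q Q hQ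
  refine ⟨fun ϰ hϰ => ?_, fun κ hκ => ?_⟩
  · obtain ⟨G₁, G₂, h⟩ := hfacq ϰ hϰ
    exact h.aDefined hQ.measurable hε (hN ϰ hϰ)
  obtain ⟨l1, l2, l3⟩ := hlead q Q hQ κ hκ
  have hκ0 : 0 < κ := by linarith
  have hαm := aestronglyMeasurable_alpha hQ.measurable hε hκ hfacq hN
  set n := sobolevNorm s κ q ^ 2 with hndef
  have hn0 : 0 ≤ n := by positivity
  have hrpow : IntegrableOn (fun ϰ : ℝ => D ^ 2 * n ^ 2 * ϰ ^ (-2 - 2 * s)) (Ioi κ) :=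
    (integrableOn_Ioi_rpow_of_lt (by linarith) hκ0).const_mul _
  -- The exponents add up to `(2s + 1) + 2(-1 - 2s) - 1 = -2 - 2s`, below `-1` exactly when `s >
  -- -1/2`.
  have hrem : ∀ ϰ ∈ Ioi κ, ‖ϰ ^ (2 * s + 1) * alpha ε ϰ q / ϰ
      - ϰ ^ (2 * s + 1) * leadingTerm ϰ Q / ϰ‖ ≤ D ^ 2 * n ^ 2 * ϰ ^ (-2 - 2 * s) := by
    intro ϰ hϰ
    have hϰ1 : 1 ≤ ϰ := hκ.trans (le_of_lt hϰ)
    have hϰ0 : 0 < ϰ := by linarith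
    obtain ⟨G₁, G₂, h⟩ := hfacq ϰ (hϰ1.trans (le_abs_self _))
    have h1 := h.abs_alpha_sub_le hs hQ hε hϰ1 (hN ϰ (hϰ1.trans (le_abs_self _)))
    rw [abs_of_pos hϰ0] at h1
    have h2 : D * ϰ ^ (-1 - 2 * s) * sobolevNorm s ϰ q ^ 2 ≤ D * ϰ ^ (-1 - 2 * s) * n := by
      gcongr
      exact hQ.sobolevNorm_sq_anti hs' hκ (le_of_lt hϰ)
    have h3 : |alpha ε ϰ q - leadingTerm ϰ Q| ≤ (D * ϰ ^ (-1 - 2 * s) * n) ^ 2 :=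
      h1.trans (pow_le_pow_left₀ (by positivity) h2 2)
    rw [← sub_div, ← mul_sub, norm_div, norm_mul, Real.norm_of_nonneg hϰ0.le,
      Real.norm_of_nonneg (by positivity : 0 ≤ ϰ ^ (2 * s + 1)), Real.norm_eq_abs]
    calc ϰ ^ (2 * s + 1) * |alpha ε ϰ q - leadingTerm ϰ Q| / ϰ
        ≤ ϰ ^ (2 * s + 1) * (D * ϰ ^ (-1 - 2 * s) * n) ^ 2 / ϰ := by gcongr
      _ = D ^ 2 * n ^ 2 * (ϰ ^ (2 * s + 1) * (ϰ ^ (-1 - 2 * s) * ϰ ^ (-1 - 2 * s))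
          * ϰ ^ (-1 : ℝ)) := by rw [Real.rpow_neg_one]; ring
      _ = D ^ 2 * n ^ 2 * ϰ ^ (-2 - 2 * s) := by
          rw [← Real.rpow_add hϰ0, ← Real.rpow_add hϰ0, ← Real.rpow_add hϰ0]
          congr 2
          ring
  have hmeas : AEStronglyMeasurable (fun ϰ : ℝ => ϰ ^ (2 * s + 1) * alpha ε ϰ q / ϰ)
      (volume.restrict (Ioi κ)) := by
    have h1 : Measurable fun ϰ : ℝ => ϰ ^ (2 * s + 1) := by fun_prop
    have h2 : Measurable fun ϰ : ℝ => ϰ⁻¹ := by fun_prop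
    simp_rw [div_eq_mul_inv]
    exact (h1.aestronglyMeasurable.mul hαm).mul h2.aestronglyMeasurable
  have hdiff : IntegrableOn (fun ϰ : ℝ => ϰ ^ (2 * s + 1) * alpha ε ϰ q / ϰ
      - ϰ ^ (2 * s + 1) * leadingTerm ϰ Q / ϰ) (Ioi κ) :=
    Integrable.mono' hrpow (hmeas.sub l1.aestronglyMeasurable)
      ((ae_restrict_iff' measurableSet_Ioi).mpr (ae_of_all _ hrem))
  have hint : IntegrableOn (fun ϰ : ℝ => ϰ ^ (2 * s + 1) * alpha ε ϰ q / ϰ) (Ioi κ) :=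
    (hdiff.add l1).congr (ae_of_all _ fun ϰ => by simp)
  have hbound : |(∫ ϰ in Ioi κ, ϰ ^ (2 * s + 1) * alpha ε ϰ q / ϰ)
      - ∫ ϰ in Ioi κ, ϰ ^ (2 * s + 1) * leadingTerm ϰ Q / ϰ| ≤ c / 2 * n := by
    rw [← integral_sub hint l1, ← Real.norm_eq_abs]
    calc _ ≤ ∫ ϰ in Ioi κ, D ^ 2 * n ^ 2 * ϰ ^ (-2 - 2 * s) :=
          norm_integral_le_of_norm_le hrpow
            ((ae_restrict_iff' measurableSet_Ioi).mpr (ae_of_all _ hrem))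
      _ = D ^ 2 * n ^ 2 * (κ ^ (-1 - 2 * s) / (1 + 2 * s)) := by
          rw [integral_const_mul, integral_Ioi_rpow_of_lt (by linarith) hκ0,
            show -2 - 2 * s + 1 = -1 - 2 * s by ring, neg_div, ← div_neg]
          congr 3
          ring
      -- One factor `n` is spent on smallness, the other is kept to match the leading term.
      _ ≤ D ^ 2 * (d * n) * (1 / (1 + 2 * s)) := by
          have h1 : κ ^ (-1 - 2 * s) ≤ 1 := Real.rpow_le_one_of_one_le_of_nonpos hκ (by linarith)
          have h2 : n ^ 2 ≤ d * n := by
            rw [sq]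
            gcongr
            exact hn κ hκ
          gcongr
      _ = D ^ 2 * d / (1 + 2 * s) * n := by ring
      _ ≤ c / 2 * n := by gcongr
  obtain ⟨hb1, hb2⟩ := abs_le.mp hbound
  refine ⟨hint, ?_, ?_⟩
  · have h1 : (max (2 / c) (C + c / 2))⁻¹ ≤ c / 2 := by
      rw [inv_le_comm₀ (by positivity) (by positivity), inv_div]
      exact le_max_left _ _
    have h2 : (max (2 / c) (C + c / 2))⁻¹ * n ≤ c / 2 * n := by gcongr
    linarith
  · have h2 : (C + c / 2) * n ≤ max (2 / c) (C + c / 2) * n := by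
      gcongr
      exact le_max_right _ _
    linarith

/-! ### Conservation laws along Schwartz orbits -/

/-- On Schwartz functions the norm is the `L²` norm after the Fourier transform and a tempered
multiplier, all continuous maps. The bootstrap needs this continuity along the orbit. -/
lemma continuous_sobolevNorm_schwartz (s : ℝ) {κ : ℝ} (hκ : 0 < κ) :
    Continuous fun f : 𝓢(ℝ, ℂ) => sobolevNorm s κ (f : 𝓢'(ℝ, ℂ)) := by
  set m : ℝ → ℂ := fun ξ => ((wt κ ξ ^ (s / 2) : ℝ) : ℂ) with hmdef
  have hm : m.HasTemperateGrowth := hasTemperateGrowth_wt_rpow hκ (s / 2)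
  have key : ∀ f : 𝓢(ℝ, ℂ), sobolevNorm s κ (f : 𝓢'(ℝ, ℂ)) =
      ‖SchwartzMap.toLpCLM ℂ ℂ 2 volume (SchwartzMap.smulLeftCLM ℂ m (𝓕 f))‖ := by
    intro f
    have hcoe : ⇑(SchwartzMap.smulLeftCLM ℂ m (𝓕 f)) = fun ζ => m ζ * 𝓕 f ζ := by
      ext ζ
      simp [SchwartzMap.smulLeftCLM_apply_apply hm]
    have hL : MemLp (fun ζ => m ζ * 𝓕 f ζ) 2 volume := by
      rw [← hcoe]
      exact SchwartzMap.memLp _ 2 volume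
    rw [sobolevNorm_eq_of_fourier hκ (Q := ⇑(𝓕 f : 𝓢(ℝ, ℂ))) ?_ hL, SchwartzMap.toLpCLM_apply]
    · refine congrArg norm ?_
      unfold SchwartzMap.toLp
      congr 1
      exact hcoe.symm
    · intro p
      rw [SchwartzMap.coe_apply]
      have := SchwartzMap.integral_fourierInv_smul_eq p (𝓕 f)
      rw [FourierTransform.fourierInv_fourier_eq] at this
      exact this.symm
  simp_rw [key]
  exact ((SchwartzMap.toLpCLM ℂ ℂ 2 volume).continuous.comp
    ((SchwartzMap.smulLeftCLM ℂ m).continuous.comp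
      (FourierTransform.fourierCLM ℂ 𝓢(ℝ, ℂ)).continuous)).norm

lemma schwartz_mem_ball {s δ : ℝ} {f : 𝓢(ℝ, ℂ)} (h : sobolevNorm s 1 (f : 𝓢'(ℝ, ℂ)) ≤ δ) :
    (f : 𝓢'(ℝ, ℂ)) ∈ ball s δ :=
  ⟨SchwartzMap.memSobolev f, h⟩

/-- Continuity argument: the bound `g ≤ δ` propagates if it improves itself. -/
lemma le_of_bootstrap {g : ℝ → ℝ} {δ : ℝ} (hg : ContinuousOn g (Icc 0 1)) (h0 : g 0 < δ)
    (step : ∀ θ ∈ Icc (0 : ℝ) 1, (∀ τ ∈ Icc 0 θ, g τ ≤ δ) → g θ < δ) :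
    ∀ θ ∈ Icc (0 : ℝ) 1, g θ < δ := by
  by_contra! hne
  obtain ⟨θ₁, hθ₁, hgt⟩ := hne
  have hK : IsCompact (Icc (0 : ℝ) 1 ∩ g ⁻¹' Ici δ) :=
    isCompact_Icc.of_isClosed_subset (hg.preimage_isClosed_of_isClosed isClosed_Icc isClosed_Ici)
      inter_subset_left
  -- At the first time with `g ≥ δ` the intermediate value theorem gives `g = δ`, so the weak bound
  -- still holds there and `step` contradicts it.
  obtain ⟨θ₀, ⟨hθ₀, hge⟩, hleast⟩ := hK.exists_isLeast ⟨θ₁, hθ₁, hgt⟩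
  have hlt : ∀ τ ∈ Icc 0 θ₀, τ < θ₀ → g τ < δ := by
    intro τ hτ hlt
    by_contra! hcon
    exact absurd (hleast ⟨⟨hτ.1, hτ.2.trans hθ₀.2⟩, hcon⟩) (not_le.mpr hlt)
  obtain ⟨c, hc, hgc⟩ := intermediate_value_Icc hθ₀.1
    (hg.mono (Icc_subset_Icc_right hθ₀.2)) ⟨h0.le, hge⟩
  have hcθ : c = θ₀ := by
    by_contra hne
    exact absurd hgc (hlt c hc (lt_of_le_of_ne hc.2 hne)).ne
  subst hcθ
  refine absurd (step c hθ₀ fun τ hτ => ?_) (not_lt.mpr hge)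
  rcases hτ.2.lt_or_eq with h | h
  · exact (hlt τ hτ h).le
  · rw [h, hgc]

lemma continuousOn_orbit {ε : ℝ} {H : 𝓢(ℝ, ℂ) → ℝ} {J : Set ℝ} {q : ℝ → 𝓢(ℝ, ℂ)}
    (h : IsHamiltonianOrbit ε H J q) : ContinuousOn q J := by
  intro t ht
  obtain ⟨_, _, _, _, hd, _⟩ := h t ht
  exact hd.hasFDerivWithinAt.continuousWithinAt

theorem exists_apriori_bound {s : ℝ} (hs : -(1 / 2) < s) (hs' : s < 0) {ε : ℝ} (hε : |ε| = 1) :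
    ∃ δ > 0, ∃ C > 0,
      (∀ q ∈ ball s δ,
        (∀ ϰ : ℝ, 1 ≤ |ϰ| → ADefined ε ϰ q) ∧
        ∀ κ : ℝ, 1 ≤ κ →
          IntegrableOn (fun ϰ : ℝ => ϰ ^ (2 * s + 1) * alpha ε ϰ q / ϰ) (Ioi κ) ∧
          C⁻¹ * sobolevNorm s κ q ^ 2 ≤ ∫ ϰ in Ioi κ, ϰ ^ (2 * s + 1) * alpha ε ϰ q / ϰ ∧
          ∫ ϰ in Ioi κ, ϰ ^ (2 * s + 1) * alpha ε ϰ q / ϰ ≤ C * sobolevNorm s κ q ^ 2) ∧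
      ∀ (J : Set ℝ) (q : ℝ → 𝓢(ℝ, ℂ)), J.OrdConnected → 0 ∈ J → ContinuousOn q J →
        ConservesA ε J q → (q 0 : 𝓢'(ℝ, ℂ)) ∈ ball s δ → ∀ t ∈ J, ∀ κ : ℝ, 1 ≤ κ →
          sobolevNorm s κ (q t : 𝓢'(ℝ, ℂ)) ≤ C * sobolevNorm s κ (q 0 : 𝓢'(ℝ, ℂ)) := by
  obtain ⟨δ, hδ, C, hC, hE⟩ := energy_estimate hs hs' hε
  have hδ' : δ / (2 * (C + 1)) ≤ δ / 2 :=
    div_le_div_of_nonneg_left hδ.le two_pos (by linarith)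
  -- This radius gives `C ‖q 0‖ < δ`, which closes the bootstrap; the `+ 1` also keeps it below `δ`
  -- when `C` is small.
  refine ⟨δ / (2 * (C + 1)), by positivity, C, hC,
    fun q hq => hE q ⟨hq.1, hq.2.trans (by linarith)⟩, ?_⟩
  intro J q hJ h0J hcont hA hq0 t ht
  have hbound : ∀ t ∈ J, (∀ τ ∈ uIcc 0 t, sobolevNorm s 1 (q τ : 𝓢'(ℝ, ℂ)) ≤ δ) →
      ∀ κ : ℝ, 1 ≤ κ →
        sobolevNorm s κ (q t : 𝓢'(ℝ, ℂ)) ≤ C * sobolevNorm s κ (q 0 : 𝓢'(ℝ, ℂ)) := by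
    intro t ht hsm κ hκ
    have hA' : ∀ ϰ ∈ Ioi κ, alpha ε ϰ (q t : 𝓢'(ℝ, ℂ)) = alpha ε ϰ (q 0 : 𝓢'(ℝ, ℂ)) := by
      intro ϰ hϰ
      have h1 : 1 ≤ |ϰ| := (hκ.trans (mem_Ioi.mp hϰ).le).trans (le_abs_self ϰ)
      unfold alpha
      rw [hA ϰ h1 t ht fun τ hτ => (hE _ (schwartz_mem_ball (hsm τ hτ))).1 ϰ h1]
    have hI : ∫ ϰ in Ioi κ, ϰ ^ (2 * s + 1) * alpha ε ϰ (q t : 𝓢'(ℝ, ℂ)) / ϰ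
        = ∫ ϰ in Ioi κ, ϰ ^ (2 * s + 1) * alpha ε ϰ (q 0 : 𝓢'(ℝ, ℂ)) / ϰ :=
      setIntegral_congr_fun measurableSet_Ioi fun ϰ hϰ => by simp only [hA' ϰ hϰ]
    have hlow := ((hE _ (schwartz_mem_ball (hsm t right_mem_uIcc))).2 κ hκ).2.1
    have hupp := ((hE _ (schwartz_mem_ball (hsm 0 left_mem_uIcc))).2 κ hκ).2.2
    rw [hI] at hlow
    have hsq := hlow.trans hupp
    -- The squared norms compare with constant `C²`, so the norms compare with the same `C` as in
    -- the energy estimate.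
    rw [inv_mul_le_iff₀ hC] at hsq
    refine abs_le_of_sq_le_sq' (hsq.trans_eq ?_) (mul_nonneg hC.le (sobolevNorm_nonneg _ _ _)) |>.2
    ring
  -- Only smallness of the norm with `κ = 1` up to time `t` remains; it gives the bound for every
  -- `κ`.
  refine hbound t ht fun τ hτ => ?_
  -- Times are written as `θ t` with `θ ∈ [0, 1]`, so that positive and negative `t` share one
  -- continuity argument.
  have hmem : ∀ θ ∈ Icc (0 : ℝ) 1, θ * t ∈ uIcc 0 t := by
    intro θ hθ
    rcases le_total 0 t with h | h
    · rw [uIcc_of_le h]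
      exact ⟨by nlinarith [hθ.1], by nlinarith [hθ.2]⟩
    · rw [uIcc_of_ge h]
      exact ⟨by nlinarith [hθ.2], by nlinarith [hθ.1]⟩
  have hsub : uIcc 0 t ⊆ J := hJ.uIcc_subset h0J ht
  have hsmall : C * sobolevNorm s 1 (q 0 : 𝓢'(ℝ, ℂ)) < δ := by
    calc C * sobolevNorm s 1 (q 0 : 𝓢'(ℝ, ℂ)) ≤ C * (δ / (2 * (C + 1))) := by
          gcongr
          exact hq0.2
      _ < δ := by
          rw [mul_div_assoc', div_lt_iff₀ (by positivity)]
          nlinarith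
  have hg : ContinuousOn (fun θ : ℝ => sobolevNorm s 1 (q (θ * t) : 𝓢'(ℝ, ℂ))) (Icc 0 1) :=
    (continuous_sobolevNorm_schwartz s one_pos).comp_continuousOn
      (hcont.comp (by fun_prop) fun θ hθ => hsub (hmem θ hθ))
  have hall := le_of_bootstrap (δ := δ) hg
    (by simpa only [zero_mul] using lt_of_le_of_lt (hq0.2.trans hδ') (by linarith))
    fun θ hθ hle => (hbound (θ * t) (hsub (hmem θ hθ)) ?_ 1 le_rfl).trans_lt hsmall
  · rcases eq_or_ne t 0 with rfl | ht0
    · have hτ0 : τ = 0 := by simpa using hτ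
      rw [hτ0]
      linarith [hq0.2]
    · have hθ : τ / t ∈ Icc (0 : ℝ) 1 := by
        rcases ht0.lt_or_gt with h | h
        · rw [uIcc_of_ge h.le] at hτ
          exact ⟨div_nonneg_of_nonpos hτ.2 h.le, (div_le_one_of_neg h).mpr hτ.1⟩
        · rw [uIcc_of_le h.le] at hτ
          exact ⟨div_nonneg hτ.1 h.le, (div_le_one h).mpr hτ.2⟩
      simpa only [div_mul_cancel₀ _ ht0] using (hall _ hθ).le
  · intro σ hσ
    rcases eq_or_ne t 0 with rfl | ht0
    · have hσ0 : σ = 0 := by simpa using hσ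
      rw [hσ0]
      linarith [hq0.2]
    · have hστ : σ / t ∈ Icc 0 θ := by
        rcases ht0.lt_or_gt with h | h
        · rw [uIcc_of_ge (mul_nonpos_of_nonneg_of_nonpos hθ.1 h.le)] at hσ
          exact ⟨div_nonneg_of_nonpos hσ.2 h.le, (div_le_iff_of_neg h).mpr hσ.1⟩
        · rw [uIcc_of_le (mul_nonneg hθ.1 h.le)] at hσ
          exact ⟨div_nonneg hσ.1 h.le, (div_le_iff₀ h).mpr hσ.2⟩
      simpa only [div_mul_cancel₀ _ ht0] using hle _ hστ

end AKNS

end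

theorem proposition4p4 (s : ℝ) (hs : -(1 / 2) < s) (hs' : s < 0)
    (ε : ℝ) (hε : ε = 1 ∨ ε = -1) :
    ∃ δ > 0, ∃ C > 0,
      (∀ q ∈ AKNS.ball s δ,
        (∀ ϰ : ℝ, 1 ≤ |ϰ| → AKNS.ADefined ε ϰ q) ∧
        ∀ κ : ℝ, 1 ≤ κ →
          IntegrableOn (fun ϰ : ℝ => ϰ ^ (2 * s + 1) * AKNS.alpha ε ϰ q / ϰ) (Ioi κ) ∧
          C⁻¹ * AKNS.sobolevNorm s κ q ^ 2
            ≤ ∫ ϰ in Ioi κ, ϰ ^ (2 * s + 1) * AKNS.alpha ε ϰ q / ϰ ∧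
          ∫ ϰ in Ioi κ, ϰ ^ (2 * s + 1) * AKNS.alpha ε ϰ q / ϰ
            ≤ C * AKNS.sobolevNorm s κ q ^ 2) ∧
      (∀ (H : 𝓢(ℝ, ℂ) → ℝ) (J : Set ℝ) (q : ℝ → 𝓢(ℝ, ℂ)),
        J.OrdConnected → 0 ∈ J →
        AKNS.IsHamiltonianOrbit ε H J q → AKNS.ConservesA ε J q →
        (q 0 : 𝓢'(ℝ, ℂ)) ∈ AKNS.ball s δ →
        ∀ t ∈ J, ∀ κ : ℝ, 1 ≤ κ →
          AKNS.sobolevNorm s κ (q t : 𝓢'(ℝ, ℂ)) ≤ C * AKNS.sobolevNorm s κ (q 0 : 𝓢'(ℝ, ℂ))) := by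
  obtain ⟨δ, hδ, C, hC, h, h'⟩ := AKNS.exists_apriori_bound hs hs' (ε := ε)
    (by rcases hε with rfl | rfl <;> simp)
  exact ⟨δ, hδ, C, hC, h, fun _ J q hJ h0 ho hA hq =>
    h' J q hJ h0 (AKNS.continuousOn_orbit ho) hA hq⟩
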